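/- Let $Y_1,\dots,Y_d$ be a basis of $\mathbb{R}^d$, $\mathcal{R}$ the lattice it generates, and $\mathcal{V}$ a unit cell of $\mathcal{R}$ (its $\mathcal{R}$-translates tile $\mathbb{R}^d$ up to null sets). Write $\langle f\rangle=\frac1{|\mathcal V|}\int_{\mathcal V}f\,dx$ and $s:e=\sum_{i,j}s_{ij}e_{ij}$. Let $\mathcal{H}$ be the space of symmetric second-order tensor fields on $\mathbb{R}^d$ with components in $L^2_{\rm per}$ (locally square integrable and $\mathcal R$-periodic). Call a fourth-order tensor elastic if it has the major and minor symmetries and is positive definite on symmetric matrices. Let $L_0$ be a constant elastic tensor, and let $L$ be an $\mathcal R$-periodic, measurable, essentially bounded field whose values $L(x)$ are elastic tensors for almost every $x$. Equip $\mathcal H$ with the energetic scalar product $(\eta,\tilde\eta)_e=\langle L_0\eta:\tilde\eta\rangle$ and set $$E_0=\{e\in\mathcal H:\ e=\tfrac12(\nabla w+\nabla w^{\top})\ \text{for some } w\in H^1_{\rm per}(\mathbb{R}^d;\mathbb{R}^d)\}.$$ Let $S$ be the space of sums of a constant symmetric field and a mean-free field of $\mathcal H$ that is divergence-free in the sense of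 distributions on $\mathbb R^d$. For every $\tau\in\mathcal H$ there is a unique $e\in E_0$ with $L_0e-\tau\in S$; it is denoted $\Gamma_0\tau$. Fix a constant symmetric matrix $\bar\varepsilon$ and define, for $e^*\in E_0$, $$J(e^*)=\tfrac12\langle L(\bar\varepsilon+e^*):(\bar\varepsilon+e^*)\rangle,\qquad N(e^*)=\tfrac12\|\Gamma_0L(\bar\varepsilon+e^*)\|_e^2 .$$ The gradient $\nabla F(e^*)$ of $F\in\{J,N\}$ is the element of $E_0$ with $(\nabla F(e^*),h)_e=\lim_{t\to0}\frac{F(e^*+th)-F(e^*)}{t}$ for all $h\in E_0$. A descent direction of $F$ at $e^*$ is a $p\in E_0$ with $(p,\nabla F(e^*))_e<0$. **Proposition.** For every $e^*\in E_0$ the gradients $\nabla J(e^*)$ and $\nabla N(e^*)$ exist and are unique, $\nabla J(e^*)=\Gamma_0L(\bar\varepsilon+e^*)$ (so that $N=\frac12\|\nabla J\|_e^2$), and $$(\nabla J(e^*),\nabla N(e^*))_e=\langle L\,\tilde e:\tilde e\rangle,\qquad \tilde e=\Gamma_0L(\bar\varepsilon+e^*).$$ If moreover $\nabla J(e^*)\neq0$,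 then this number is positive; consequently $-\nabla N(e^*)$ is a descent direction for $J$ at $e^*$ and, reciprocally, $-\nabla J(e^*)$ is a descent direction for $N$ at $e^*$. -/

import Mathlib

open MeasureTheory Filter Topology
open scoped ContDiff

noncomputable section

namespace PeriodicElasticity

/-- The physical space `ℝ^d`, with its Euclidean structure. -/
abbrev Pt (d : ℕ) : Type := EuclideanSpace ℝ (Fin d)

/-- Real functions on `ℝ^d`, measurable, up to equality almost everywhere. -/
abbrev ScalarField (d : ℕ) : Type := Pt d →ₘ[volume] ℝ

/-- Second-order tensor fields, given by their components. -/
abbrev TensorField (d : ℕ) : Type := Fin d → Fin d → ScalarField d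

/-- Fourth-order tensors. -/
abbrev Tensor4 (d : ℕ) : Type := Fin d → Fin d → Fin d → Fin d → ℝ

/-- Fourth-order tensor fields. -/
abbrev Tensor4Field (d : ℕ) : Type := Fin d → Fin d → Fin d → Fin d → ScalarField d

/-- The lattice of integer combinations of the periods `Y₁, …, Y_d`. -/
abbrev lattice {d : ℕ} (Y : Module.Basis (Fin d) ℝ (Pt d)) : Submodule ℤ (Pt d) :=
  Submodule.span ℤ (Set.range Y)

/-- `V` is a unit cell: its translates by the lattice tile `ℝ^d` up to null sets. -/
def IsUnitCell {d : ℕ} (Y : Module.Basis (Fin d) ℝ (Pt d)) (V : Set (Pt d)) : Prop :=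
  IsAddFundamentalDomain (lattice Y) V volume

/-- Invariance almost everywhere under all translations of the lattice. -/
def IsPeriodic {d : ℕ} (Y : Module.Basis (Fin d) ℝ (Pt d)) (f : ScalarField d) : Prop :=
  ∀ y ∈ lattice Y, ∀ᵐ x ∂(volume : Measure (Pt d)), f (x + y) = f x

/-- `L²_per`: periodic functions that are square integrable on every compact set. -/
def L2per {d : ℕ} (Y : Module.Basis (Fin d) ℝ (Pt d)) : Set (ScalarField d) :=
  {f | (∀ K : Set (Pt d), IsCompact K → MemLp f 2 (volume.restrict K)) ∧ IsPeriodic Y f}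

/-- The partial derivative `∂_j φ` of a differentiable function. -/
def partialDeriv {d : ℕ} (j : Fin d) (φ : Pt d → ℝ) (x : Pt d) : ℝ :=
  fderiv ℝ φ x (EuclideanSpace.single j 1)

/-- `g = ∂_j f` in the sense of distributions on `ℝ^d`
(meant for locally integrable `f` and `g`). -/
def IsWeakPartial {d : ℕ} (j : Fin d) (f g : ScalarField d) : Prop :=
  ∀ φ : Pt d → ℝ, ContDiff ℝ ∞ φ → HasCompactSupport φ →
    ∫ x, f x * partialDeriv j φ x = -∫ x, g x * φ x

/-- `f` belongs to `H¹_per` and `G = (∂_1 f, …, ∂_d f)` is its weak gradient. -/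
def IsH1perWithGradient {d : ℕ} (Y : Module.Basis (Fin d) ℝ (Pt d))
    (f : ScalarField d) (G : Fin d → ScalarField d) : Prop :=
  f ∈ L2per Y ∧ ∀ j, G j ∈ L2per Y ∧ IsWeakPartial j f (G j)

/-- The symmetric tensor fields with components in `L²_per`. Equipped with the strain scalar
product this is the space `H_e` of strain fields; it is also the set of stress fields `H_s`. -/
def SymL2per {d : ℕ} (Y : Module.Basis (Fin d) ℝ (Pt d)) : Set (TensorField d) :=
  {η | (∀ i j, η i j = η j i) ∧ ∀ i j, η i j ∈ L2per Y}

/-- The uniform tensor field with value `A`. -/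
def uniformField {d : ℕ} (A : Matrix (Fin d) (Fin d) ℝ) : TensorField d :=
  fun i j => AEEqFun.const (Pt d) (A i j)

/-- The action of a uniform fourth-order tensor: `(C η)_{ij} = ∑_{kl} C_{ijkl} η_{kl}`. -/
def Tensor4.act {d : ℕ} (C : Tensor4 d) (η : TensorField d) : TensorField d :=
  fun i j => ∑ k, ∑ l, C i j k l • η k l

/-- The pointwise action of a fourth-order tensor field:
`(L η)_{ij}(x) = ∑_{kl} L_{ijkl}(x) η_{kl}(x)`. -/
def Tensor4Field.act {d : ℕ} (L : Tensor4Field d) (η : TensorField d) : TensorField d :=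
  fun i j => ∑ k, ∑ l, L i j k l * η k l

/-- An elasticity tensor: major and minor symmetries, and positive definite on symmetric
matrices. -/
structure IsElasticityTensor {d : ℕ} (C : Tensor4 d) : Prop where
  major : ∀ i j k l, C i j k l = C k l i j
  minor_left : ∀ i j k l, C i j k l = C j i k l
  minor_right : ∀ i j k l, C i j k l = C i j l k
  pos : ∀ A : Matrix (Fin d) (Fin d) ℝ, A.IsSymm → A ≠ 0 →
    0 < ∑ i, ∑ j, ∑ k, ∑ l, C i j k l * A k l * A i j

/-- A periodic, essentially bounded field whose values are elasticity tensors. -/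
structure IsElasticityField {d : ℕ} (Y : Module.Basis (Fin d) ℝ (Pt d))
    (L : Tensor4Field d) : Prop where
  elastic : ∀ᵐ x ∂(volume : Measure (Pt d)), IsElasticityTensor (fun i j k l => L i j k l x)
  periodic : ∀ i j k l, IsPeriodic Y (L i j k l)
  bounded : ∃ M : ℝ, ∀ i j k l, ∀ᵐ x ∂(volume : Measure (Pt d)), |L i j k l x| ≤ M

/-- The duality product `⟪τ, η⟫ = ⟨τ : η⟩`, the average over `V` of `∑_{ij} τ_{ij} η_{ij}`. -/
def duality {d : ℕ} (V : Set (Pt d)) (τ η : TensorField d) : ℝ :=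
  ⨍ x in V, ∑ i, ∑ j, τ i j x * η i j x

/-- The energetic scalar product on strain fields, `(η, η') = ⟨L₀ η : η'⟩`. -/
def strainInner {d : ℕ} (V : Set (Pt d)) (L₀ : Tensor4 d) (η η' : TensorField d) : ℝ :=
  duality V (L₀.act η) η'

/-- `E₀`: the strain fields that are the symmetrized gradient of some `w ∈ H¹_per`,
where `G i j = ∂_j w_i`. -/
def E₀ {d : ℕ} (Y : Module.Basis (Fin d) ℝ (Pt d)) : Set (TensorField d) :=
  {e | e ∈ SymL2per Y ∧ ∃ (w : Fin d → ScalarField d) (G : TensorField d),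
    (∀ i, IsH1perWithGradient Y (w i) (G i)) ∧
    ∀ i j, e i j = (1 / 2 : ℝ) • (G i j + G j i)}

/-- `S₀`: the stress fields that are divergence-free and of zero average. The divergence of the
periodic field is taken in the sense of distributions on all of `ℝ^d`, which for a field that
is smooth up to the boundary of the cell says that `div s = 0` inside the cell and that `s n`
takes opposite values on opposite faces. -/
def S₀ {d : ℕ} (Y : Module.Basis (Fin d) ℝ (Pt d)) (V : Set (Pt d)) : Set (TensorField d) :=
  {s | s ∈ SymL2per Y ∧
    (∀ i, ∀ φ : Pt d → ℝ, ContDiff ℝ ∞ φ → HasCompactSupport φ →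
      ∑ j, ∫ x, s i j x * partialDeriv j φ x = 0) ∧
    ∀ i j, ⨍ x in V, s i j x = 0}

/-- `S = U_s + S₀`: the statically admissible stress fields. -/
def S {d : ℕ} (Y : Module.Basis (Fin d) ℝ (Pt d)) (V : Set (Pt d)) : Set (TensorField d) :=
  {s | ∃ A : Matrix (Fin d) (Fin d) ℝ, A.IsSymm ∧ ∃ s₀ ∈ S₀ Y V, s = uniformField A + s₀}

/-- `e` solves the Eshelby problem with polarization `τ`: `e ∈ E₀` and `L₀ e - τ ∈ S`. -/
def IsEshelbySolution {d : ℕ} (Y : Module.Basis (Fin d) ℝ (Pt d)) (V : Set (Pt d))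
    (L₀ : Tensor4 d) (τ e : TensorField d) : Prop :=
  e ∈ E₀ Y ∧ L₀.act e - τ ∈ S Y V

open Classical in
/-- The strain Green's operator `Γ₀` of the reference medium: `Γ₀ τ` is the solution of the
Eshelby problem with polarization `τ` (and `0` where there is none). -/
def Γ₀ {d : ℕ} (Y : Module.Basis (Fin d) ℝ (Pt d)) (V : Set (Pt d))
    (L₀ : Tensor4 d) (τ : TensorField d) : TensorField d :=
  if h : ∃ e, IsEshelbySolution Y V L₀ τ e then h.choose else 0

/-- The energy functional `J(e*) = ½ ⟨L (ε̄ + e*) : (ε̄ + e*)⟩`. -/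
def J {d : ℕ} (V : Set (Pt d)) (L : Tensor4Field d) (ε : Matrix (Fin d) (Fin d) ℝ)
    (e : TensorField d) : ℝ :=
  1 / 2 * duality V (L.act (uniformField ε + e)) (uniformField ε + e)

/-- The geometric functional `N(e*) = ½ ‖Γ₀ L (ε̄ + e*)‖²`, for the norm of the energetic
scalar product. -/
def N {d : ℕ} (Y : Module.Basis (Fin d) ℝ (Pt d)) (V : Set (Pt d)) (L₀ : Tensor4 d)
    (L : Tensor4Field d) (ε : Matrix (Fin d) (Fin d) ℝ) (e : TensorField d) : ℝ :=
  1 / 2 * strainInner V L₀ (Γ₀ Y V L₀ (L.act (uniformField ε + e)))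
    (Γ₀ Y V L₀ (L.act (uniformField ε + e)))

/-- `g` is the gradient at `e` of the functional `F` on `E₀` endowed with the energetic scalar
product: `g ∈ E₀` represents all directional derivatives of `F` at `e` along `E₀`. -/
def IsGradient {d : ℕ} (Y : Module.Basis (Fin d) ℝ (Pt d)) (V : Set (Pt d)) (L₀ : Tensor4 d)
    (F : TensorField d → ℝ) (e g : TensorField d) : Prop :=
  g ∈ E₀ Y ∧ ∀ h ∈ E₀ Y,
    Tendsto (fun t : ℝ => (F (e + t • h) - F e) / t) (𝓝[≠] 0) (𝓝 (strainInner V L₀ g h))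

/-- `p ∈ E₀` is a descent direction of `F` at `e`: its energetic scalar product with the
gradient of `F` at `e` is negative. -/
def IsDescentDirection {d : ℕ} (Y : Module.Basis (Fin d) ℝ (Pt d)) (V : Set (Pt d))
    (L₀ : Tensor4 d) (F : TensorField d → ℝ) (e p : TensorField d) : Prop :=
  p ∈ E₀ Y ∧ ∃ g, IsGradient Y V L₀ F e g ∧ strainInner V L₀ p g < 0

end PeriodicElasticity

end

/-! Both functionals are quadratic on `E₀`, and everything rests on one identity: (Γ₀τ, h)_e = ⟨τ :
h⟩ for h in `E₀` (`strainInner_Γ₀`). It holds because L₀Γ₀τ - τ is statically admissible, and such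
stresses are orthogonal to compatible strains. Hence the derivative ⟨L(ε̄ + e*) : h⟩ of J is
represented by g = Γ₀L(ε̄ + e*). As Γ₀ is linear, the derivative of N is (g, Γ₀Lh)_e = ⟨Lh : g⟩ =
⟨Lg : h⟩ = (Γ₀Lg, h)_e, by the identity used twice and the major symmetry of L; so ∇N = Γ₀Lg. One
more use gives (∇J, ∇N)_e = ⟨Lg : g⟩, which is positive for g ≠ 0 because L is positive definite
almost everywhere.

The bulk of the work is the existence of Γ₀ and the orthogonality, both obtained from Fourier
series. Coordinates in the basis of periods identify periodic functions with functions on the torus,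
and the average over any unit cell with the Haar integral. Weak derivatives, tested on ℝ^d with
compact supports, are equivalent to relations between Fourier coefficients (`weak_divergence_iff`).
Orthogonality is then Parseval's identity (`duality_eq_zero_of_isDivFree`). The Eshelby problem
decouples into one d × d system per frequency, whose matrix is the acoustic tensor at the wave
vector κ; its inverse is O(|κ|⁻²) (`exists_acoustic_inv_bound`), which makes the solution square
summable together with its gradient (`exists_isEshelbySolution`). Uniqueness follows from the
positivity of the energetic product. -/

open scoped Pointwise ComplexConjugate Convolution

noncomputable section

namespace PeriodicElasticity

/-! ### The torus as the quotient of the space by the lattice -/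

/-- The circle `ℝ / ℤ` carries its Haar probability measure. -/
abbrev circleMeasureSpace : MeasureSpace UnitAddCircle := ⟨AddCircle.haarAddCircle⟩

attribute [local instance] circleMeasureSpace

instance : Measure.IsAddHaarMeasure (volume : Measure UnitAddCircle) :=
  inferInstanceAs (Measure.IsAddHaarMeasure AddCircle.haarAddCircle)

instance : IsProbabilityMeasure (volume : Measure UnitAddCircle) :=
  inferInstanceAs (IsProbabilityMeasure AddCircle.haarAddCircle)

/-- The torus `(ℝ / ℤ)^d`. -/
abbrev Torus (d : ℕ) : Type := UnitAddTorus (Fin d)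

variable {d : ℕ} (Y : Module.Basis (Fin d) ℝ (Pt d))

/-- The covering map of the torus given by the coordinates in the basis of periods. -/
def toTorus (x : Pt d) : Torus d := fun i => ((Y.repr x i : ℝ) : UnitAddCircle)

/-- A measurable section of `toTorus`. -/
def ofTorus (θ : Torus d) : Pt d :=
  Y.equivFun.symm fun i => (AddCircle.equivIoc (1 : ℝ) 0 (θ i) : ℝ)

theorem continuous_repr (i : Fin d) : Continuous fun x : Pt d => Y.repr x i :=
  LinearMap.continuous_of_finiteDimensional (Y.coord i)

theorem continuous_toTorus : Continuous (toTorus Y) :=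
  continuous_pi fun i => (AddCircle.continuous_mk' 1).comp (continuous_repr Y i)

theorem measurable_toTorus : Measurable (toTorus Y) :=
  measurable_pi_lambda _ fun i =>
    AddCircle.measurable_mk'.comp (continuous_repr Y i).measurable

theorem measurable_ofTorus : Measurable (ofTorus Y) := by
  have h : Continuous fun v => Y.equivFun.symm v :=
    LinearMap.continuous_of_finiteDimensional Y.equivFun.symm.toLinearMap
  refine h.measurable.comp (measurable_pi_lambda _ fun i => ?_)
  exact measurable_subtype_coe.comp
    ((AddCircle.measurableEquivIoc (1 : ℝ) 0).measurable.comp (measurable_pi_apply i))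

theorem toTorus_ofTorus (θ : Torus d) : toTorus Y (ofTorus Y θ) = θ := by
  funext i
  have : Y.repr (ofTorus Y θ) i = (AddCircle.equivIoc (1 : ℝ) 0 (θ i) : ℝ) := by
    rw [ofTorus, ← Module.Basis.equivFun_apply, LinearEquiv.apply_symm_apply]
  rw [toTorus, this]
  exact (AddCircle.equivIoc (1 : ℝ) 0).symm_apply_apply (θ i)

theorem toTorus_add (x y : Pt d) : toTorus Y (x + y) = toTorus Y x + toTorus Y y := by
  funext i
  simp [toTorus]

theorem toTorus_neg (x : Pt d) : toTorus Y (-x) = -toTorus Y x := by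
  funext i
  simp [toTorus]

theorem toTorus_eq_zero_iff (x : Pt d) : toTorus Y x = 0 ↔ x ∈ lattice Y := by
  rw [lattice, Y.mem_span_iff_repr_mem ℤ x, funext_iff]
  refine forall_congr' fun i => ?_
  simp only [toTorus, Pi.zero_apply, AddCircle.coe_eq_zero_iff, Set.mem_range]
  simp

theorem toTorus_add_lattice (x : Pt d) {y : Pt d} (hy : y ∈ lattice Y) :
    toTorus Y (x + y) = toTorus Y x := by
  rw [toTorus_add, (toTorus_eq_zero_iff Y y).2 hy, add_zero]

theorem ofTorus_toTorus_sub_mem (x : Pt d) : ofTorus Y (toTorus Y x) - x ∈ lattice Y := by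
  rw [← toTorus_eq_zero_iff, sub_eq_add_neg, toTorus_add, toTorus_neg, toTorus_ofTorus,
    add_neg_cancel]

instance : Countable (lattice Y) := by
  infer_instance

instance : VAddInvariantMeasure (lattice Y) (Pt d) volume :=
  ⟨fun g s _ => measure_preimage_add volume (g : Pt d) s⟩

theorem vadd_preimage_toTorus (A : Set (Torus d)) (g : lattice Y) :
    (fun x : Pt d => g +ᵥ x) ⁻¹' (toTorus Y ⁻¹' A) = toTorus Y ⁻¹' A := by
  ext x
  simp only [Set.mem_preimage]
  rw [show g +ᵥ x = x + (g : Pt d) from add_comm _ _, toTorus_add_lattice Y x g.2]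

/-- The torus integral is computed on the cube (0, 1]^d while `ZSpan.fundamentalDomain` corresponds
to [0, 1)^d; both agree with the closed cube up to a null set. -/
theorem restrict_unit_cube :
    (volume : Measure (Fin d → ℝ)).restrict {x | ∀ i, x i ∈ Set.Ioc (0 : ℝ) (0 + 1)} =
      volume.restrict {x | ∀ i, x i ∈ Set.Ico (0 : ℝ) 1} := by
  have h1 := Measure.univ_pi_Ioc_ae_eq_Icc (ι := Fin d) (μ := fun _ => (volume : Measure ℝ))
    (f := fun _ => 0) (g := fun _ => 1)
  have h2 := Measure.univ_pi_Ico_ae_eq_Icc (ι := Fin d) (μ := fun _ => (volume : Measure ℝ))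
    (f := fun _ => 0) (g := fun _ => 1)
  rw [← volume_pi] at h1 h2
  refine Measure.restrict_congr_set ?_
  have e1 : {x : Fin d → ℝ | ∀ i, x i ∈ Set.Ioc (0 : ℝ) (0 + 1)} =
      Set.univ.pi fun _ => Set.Ioc 0 1 := by ext x; simp
  have e2 : {x : Fin d → ℝ | ∀ i, x i ∈ Set.Ico (0 : ℝ) 1} =
      Set.univ.pi fun _ => Set.Ico 0 1 := by ext x; simp
  rw [e1, e2]
  exact h1.trans h2.symm

/-! ### Lebesgue measure on cells and Haar measure on the torus -/

/-- The covering map sends the Lebesgue measure of a unit cell to a multiple of the Haar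
measure of the torus. -/
theorem exists_map_toTorus :
    ∃ c : NNReal, c ≠ 0 ∧ ∀ W : Set (Pt d), IsUnitCell Y W →
      Measure.map (toTorus Y) ((volume : Measure (Pt d)).restrict W) =
        c • (volume : Measure (Torus d)) := by
  let e : Pt d ≃L[ℝ] (Fin d → ℝ) := Y.equivFun.toContinuousLinearEquiv
  have he : Measure.IsAddHaarMeasure (Measure.map e (volume : Measure (Pt d))) :=
    e.isAddHaarMeasure_map volume
  -- The constant compares two Haar measures on coordinate space, so it depends on `Y` alone and not
  -- on the cell `W`.
  let c := Measure.addHaarScalarFactor (Measure.map e (volume : Measure (Pt d))) volume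
  have hc : Measure.map e (volume : Measure (Pt d)) = c • volume :=
    Measure.isAddLeftInvariant_eq_smul _ _
  refine ⟨c, (Measure.addHaarScalarFactor_pos_of_isAddHaarMeasure _ _).ne', fun W hW => ?_⟩
  have hP := ZSpan.isAddFundamentalDomain Y (volume : Measure (Pt d))
  ext A hA
  have hqA : MeasurableSet (toTorus Y ⁻¹' A) := measurable_toTorus Y hA
  -- A lattice-invariant set has the same measure inside every fundamental domain, so `W` may be
  -- replaced by the standard parallelepiped.
  rw [Measure.map_apply (measurable_toTorus Y) hA, Measure.restrict_apply hqA,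
    hW.measure_set_eq hP hqA (vadd_preimage_toTorus Y A)]
  let m : (Fin d → ℝ) → Torus d := fun v i => (v i : UnitAddCircle)
  have hm : Measurable m := measurable_pi_lambda _ fun i =>
    AddCircle.measurable_mk'.comp (measurable_pi_apply i)
  have hC : MeasurableSet {x : Fin d → ℝ | ∀ i, x i ∈ Set.Ico (0 : ℝ) 1} := by
    have := MeasurableSet.univ_pi (fun i : Fin d => measurableSet_Ico (a := (0 : ℝ)) (b := 1))
    convert this using 1
    ext x; simp
  have hset : toTorus Y ⁻¹' A ∩ ZSpan.fundamentalDomain Y =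
      e ⁻¹' (m ⁻¹' A ∩ {x | ∀ i, x i ∈ Set.Ico (0 : ℝ) 1}) := by
    ext x
    rfl
  have h1 := UnitAddTorus.lintegral_preimage (A.indicator 1) (fun _ : Fin d => (0 : ℝ))
  rw [lintegral_indicator_one hA, restrict_unit_cube] at h1
  have h2 : ∀ v : Fin d → ℝ, A.indicator (1 : Torus d → ENNReal) (fun i => (v i : UnitAddCircle)) =
      (m ⁻¹' A).indicator 1 v := fun v => rfl
  simp_rw [h2] at h1
  rw [lintegral_indicator_one (hm hA), Measure.restrict_apply (hm hA)] at h1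
  rw [hset, ← Measure.map_apply e.continuous.measurable ((hm hA).inter hC), hc,
    Measure.smul_apply, Measure.smul_apply, h1]

/-- The volume of the unit cells. -/
def cellVolume : NNReal := (exists_map_toTorus Y).choose

theorem cellVolume_ne_zero : cellVolume Y ≠ 0 := (exists_map_toTorus Y).choose_spec.1

variable {Y}

theorem IsUnitCell.map_toTorus {W : Set (Pt d)} (hW : IsUnitCell Y W) :
    Measure.map (toTorus Y) ((volume : Measure (Pt d)).restrict W) =
      cellVolume Y • (volume : Measure (Torus d)) :=
  (exists_map_toTorus Y).choose_spec.2 W hW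

theorem IsUnitCell.volume_eq {W : Set (Pt d)} (hW : IsUnitCell Y W) :
    volume W = cellVolume Y := by
  have h := congrArg (fun μ => μ Set.univ) hW.map_toTorus
  rw [Measure.map_apply (measurable_toTorus Y) MeasurableSet.univ] at h
  simpa using h

variable (Y)

theorem isUnitCell_fundamentalDomain : IsUnitCell Y (ZSpan.fundamentalDomain Y) :=
  ZSpan.isAddFundamentalDomain Y volume

/-- The preimage of a null set is lattice invariant and its trace on one cell is null, hence it is
null. -/
theorem quasiMeasurePreserving_toTorus :
    Measure.QuasiMeasurePreserving (toTorus Y) volume volume := by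
  refine ⟨measurable_toTorus Y, Measure.AbsolutelyContinuous.mk fun A hA h0 => ?_⟩
  rw [Measure.map_apply (measurable_toTorus Y) hA]
  have hP := isUnitCell_fundamentalDomain Y
  refine hP.measure_zero_of_invariant _ (fun g => ?_) ?_
  · rw [← neg_neg g, ← Set.preimage_vadd]
    exact vadd_preimage_toTorus Y A (-g)
  · rw [← Measure.restrict_apply (measurable_toTorus Y hA),
      ← Measure.map_apply (measurable_toTorus Y) hA, hP.map_toTorus]
    simp [h0]

/-- A point whose representative lies in `A` belongs to a lattice translate of `A`, and there are
countably many translates. Together with the previous lemma this lets almost-everywhere statements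
travel both ways. -/
theorem quasiMeasurePreserving_ofTorus :
    Measure.QuasiMeasurePreserving (ofTorus Y) volume volume := by
  refine ⟨measurable_ofTorus Y, Measure.AbsolutelyContinuous.mk fun A hA h0 => ?_⟩
  rw [Measure.map_apply (measurable_ofTorus Y) hA]
  have hP := isUnitCell_fundamentalDomain Y
  have hB := measurable_ofTorus Y hA
  have h := congrArg (fun μ => μ (ofTorus Y ⁻¹' A)) hP.map_toTorus
  simp only [Measure.smul_apply] at h
  rw [Measure.map_apply (measurable_toTorus Y) hB] at h
  have hz : (volume : Measure (Pt d)) (toTorus Y ⁻¹' (ofTorus Y ⁻¹' A)) = 0 := by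
    have hsub : toTorus Y ⁻¹' (ofTorus Y ⁻¹' A) ⊆ ⋃ g : lattice Y, (fun x => x + (g : Pt d)) ⁻¹' A := by
      intro x hx
      refine Set.mem_iUnion.2 ⟨⟨_, ofTorus_toTorus_sub_mem Y x⟩, ?_⟩
      simpa using hx
    refine measure_mono_null hsub (measure_iUnion_null fun g => ?_)
    rw [measure_preimage_add_right, h0]
  rw [Measure.restrict_apply (measurable_toTorus Y hB), measure_mono_null Set.inter_subset_left hz] at h
  have := h.symm
  simpa [ENNReal.smul_def, cellVolume_ne_zero Y] using this

/-- The covering map sends the Lebesgue measure of a bounded set below a multiple of the Haar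
measure of the torus. -/
theorem exists_map_toTorus_le {K : Set (Pt d)} (hK : Bornology.IsBounded K) :
    ∃ C : NNReal, Measure.map (toTorus Y) ((volume : Measure (Pt d)).restrict K) ≤
      C • (volume : Measure (Torus d)) := by
  have hP := isUnitCell_fundamentalDomain Y
  -- Only finitely many lattice vectors carry a point of `K` into the fundamental cell, and each
  -- contributes at most the measure of one cell; `C` counts them.
  have hfin := ZSpan.setFinite_inter Y ((ZSpan.fundamentalDomain_isBounded Y).sub hK)
  have hfin' : {g : lattice Y | (g : Pt d) ∈ ZSpan.fundamentalDomain Y - K}.Finite := by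
    refine Set.Finite.of_finite_image (f := Subtype.val) (hfin.subset ?_)
      Subtype.val_injective.injOn
    rintro _ ⟨g, hg, rfl⟩
    exact ⟨hg, g.2⟩
  let s := hfin'.toFinset
  refine ⟨s.card * cellVolume Y, Measure.le_iff.2 fun A hA => ?_⟩
  have hqA := measurable_toTorus Y hA
  rw [Measure.map_apply (measurable_toTorus Y) hA, Measure.restrict_apply hqA,
    hP.measure_eq_tsum, tsum_eq_sum (s := s)]
  · have hle : ∀ g ∈ s, (volume : Measure (Pt d))
        ((g +ᵥ (toTorus Y ⁻¹' A ∩ K)) ∩ ZSpan.fundamentalDomain Y) ≤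
          (cellVolume Y • (volume : Measure (Torus d))) A := by
      intro g _
      rw [← hP.map_toTorus, Measure.map_apply (measurable_toTorus Y) hA, Measure.restrict_apply hqA]
      refine measure_mono (Set.inter_subset_inter_left _ ?_)
      rintro _ ⟨x, hx, rfl⟩
      have := vadd_preimage_toTorus Y A g
      have hx' := hx.1
      rw [← this] at hx'
      exact hx'
    refine (Finset.sum_le_card_nsmul _ _ _ hle).trans ?_
    rw [mul_smul, Measure.smul_apply (s.card : NNReal), ENNReal.smul_def, nsmul_eq_mul]
    exact le_rfl
  · intro g hg
    refine (congrArg _ (Set.eq_empty_iff_forall_notMem.2 ?_)).trans measure_empty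
    rintro _ ⟨⟨x, hx, rfl⟩, hgx⟩
    refine hg (hfin'.mem_toFinset.2 ?_)
    exact ⟨_, hgx, x, hx.2, by simp [Submodule.vadd_def]⟩

variable {Y}

/-! ### Transfer of periodic functions to the torus -/

/-- Invariance almost everywhere under the translations of the lattice, for functions. -/
def AEPeriodic (Y : Module.Basis (Fin d) ℝ (Pt d)) (h : Pt d → ℝ) : Prop :=
  ∀ y ∈ lattice Y, ∀ᵐ x ∂(volume : Measure (Pt d)), h (x + y) = h x

/-- The lattice is countable, so the exceptional sets of all translations can be discarded at once;
the function then factors through the torus almost everywhere. -/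
theorem AEPeriodic.ae_eq {h : Pt d → ℝ} (hh : AEPeriodic Y h) :
    ∀ᵐ x ∂(volume : Measure (Pt d)), h (ofTorus Y (toTorus Y x)) = h x := by
  have h1 : ∀ᵐ x ∂(volume : Measure (Pt d)), ∀ y : lattice Y, h (x + y) = h x :=
    ae_all_iff.2 fun y => hh y y.2
  filter_upwards [h1] with x hx
  simpa using hx ⟨_, ofTorus_toTorus_sub_mem Y x⟩

theorem ae_shift {p : Pt d → Prop} (hp : ∀ᵐ x ∂(volume : Measure (Pt d)), p x) (y : Pt d) :
    ∀ᵐ x ∂(volume : Measure (Pt d)), p (x + y) :=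
  (measurePreserving_add_right volume y).quasiMeasurePreserving.ae hp

theorem AEPeriodic.congr {h h' : Pt d → ℝ} (hh : AEPeriodic Y h) (e : h =ᵐ[volume] h') :
    AEPeriodic Y h' := by
  intro y hy
  filter_upwards [hh y hy, e, ae_shift e y] with x h1 h2 h3
  rw [← h3, h1, h2]

theorem AEPeriodic.add {h h' : Pt d → ℝ} (hh : AEPeriodic Y h) (hh' : AEPeriodic Y h') :
    AEPeriodic Y (fun x => h x + h' x) := by
  intro y hy
  filter_upwards [hh y hy, hh' y hy] with x h1 h2
  rw [h1, h2]

theorem AEPeriodic.mul {h h' : Pt d → ℝ} (hh : AEPeriodic Y h) (hh' : AEPeriodic Y h') :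
    AEPeriodic Y (fun x => h x * h' x) := by
  intro y hy
  filter_upwards [hh y hy, hh' y hy] with x h1 h2
  rw [h1, h2]

theorem AEPeriodic.const (a : ℝ) : AEPeriodic Y (fun _ => a) :=
  fun _ _ => ae_of_all _ fun _ => rfl

theorem AEPeriodic.sum {ι : Type*} (s : Finset ι) {h : ι → Pt d → ℝ}
    (hh : ∀ i ∈ s, AEPeriodic Y (h i)) : AEPeriodic Y (fun x => ∑ i ∈ s, h i x) := by
  intro y hy
  have := (s.eventually_all (l := ae volume)).2 fun i hi => hh i hi y hy
  filter_upwards [this] with x hx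
  exact Finset.sum_congr rfl hx

theorem aestronglyMeasurable_comp_ofTorus {h : Pt d → ℝ} (hm : AEStronglyMeasurable h volume) :
    AEStronglyMeasurable (fun θ => h (ofTorus Y θ)) (volume : Measure (Torus d)) :=
  hm.comp_quasiMeasurePreserving (quasiMeasurePreserving_ofTorus Y)

theorem AEPeriodic.setIntegral {h : Pt d → ℝ} (hh : AEPeriodic Y h)
    (hm : AEStronglyMeasurable h volume) {W : Set (Pt d)} (hW : IsUnitCell Y W) :
    ∫ x in W, h x = cellVolume Y * ∫ θ, h (ofTorus Y θ) := by
  have h1 : ∫ x in W, h x = ∫ x in W, h (ofTorus Y (toTorus Y x)) :=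
    integral_congr_ae (ae_restrict_of_ae (hh.ae_eq.mono fun x hx => hx.symm))
  have hm' := aestronglyMeasurable_comp_ofTorus (Y := Y) hm
  have h2 := integral_map (measurable_toTorus Y).aemeasurable
    (f := fun θ => h (ofTorus Y θ)) (μ := volume.restrict W) (by
      rw [hW.map_toTorus]; exact hm'.smul_measure _)
  rw [h1, ← h2, hW.map_toTorus, integral_smul_nnreal_measure]
  rfl

/-- The cell volume cancels and `W` disappears from the right-hand side: all averages become
integrals for the Haar probability measure. -/
theorem AEPeriodic.setAverage {h : Pt d → ℝ} (hh : AEPeriodic Y h)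
    (hm : AEStronglyMeasurable h volume) {W : Set (Pt d)} (hW : IsUnitCell Y W) :
    ⨍ x in W, h x = ∫ θ, h (ofTorus Y θ) := by
  have hc : (cellVolume Y : ℝ) ≠ 0 := by exact_mod_cast cellVolume_ne_zero Y
  rw [setAverage_eq, hh.setIntegral hm hW, measureReal_def, hW.volume_eq, smul_eq_mul,
    ENNReal.coe_toReal, inv_mul_cancel_left₀ hc]

theorem AEPeriodic.memLp_ofTorus {h : Pt d → ℝ} (hh : AEPeriodic Y h)
    (hm : AEStronglyMeasurable h volume) {W : Set (Pt d)} (hW : IsUnitCell Y W) {p : ENNReal}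
    (hp : MemLp h p (volume.restrict W)) :
    MemLp (fun θ => h (ofTorus Y θ)) p (volume : Measure (Torus d)) := by
  have hm' := aestronglyMeasurable_comp_ofTorus (Y := Y) hm
  have h1 : MemLp (fun x => h (ofTorus Y (toTorus Y x))) p (volume.restrict W) :=
    (memLp_congr_ae (ae_restrict_of_ae hh.ae_eq)).2 hp
  have h2 : MemLp (fun θ => h (ofTorus Y θ)) p
      (Measure.map (toTorus Y) (volume.restrict W)) :=
    (memLp_map_measure_iff (by rw [hW.map_toTorus]; exact hm'.smul_measure _)
      (measurable_toTorus Y).aemeasurable).2 h1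
  rw [hW.map_toTorus] at h2
  have h3 := h2.smul_measure (c := ((cellVolume Y)⁻¹ : NNReal)) ENNReal.coe_ne_top
  rwa [ENNReal.smul_def, smul_smul, ← ENNReal.coe_mul, inv_mul_cancel₀ (cellVolume_ne_zero Y),
    ENNReal.coe_one, one_smul] at h3

theorem memLp_comp_toTorus {F : Torus d → ℝ} {p : ENNReal} (hF : MemLp F p volume)
    {K : Set (Pt d)} (hK : Bornology.IsBounded K) :
    MemLp (fun x => F (toTorus Y x)) p (volume.restrict K) := by
  obtain ⟨C, hC⟩ := exists_map_toTorus_le Y hK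
  have h1 : MemLp F p (Measure.map (toTorus Y) (volume.restrict K)) :=
    (hF.smul_measure (c := (C : ENNReal)) ENNReal.coe_ne_top).mono_measure hC
  exact h1.comp_of_map (measurable_toTorus Y).aemeasurable

theorem memLp_ofTorus_of_mem {f : ScalarField d} (hf : f ∈ L2per Y) :
    MemLp (fun θ => f (ofTorus Y θ)) 2 (volume : Measure (Torus d)) := by
  have hb := ZSpan.fundamentalDomain_isBounded Y
  have h1 : MemLp f 2 (volume.restrict (ZSpan.fundamentalDomain Y)) :=
    (hf.1 _ hb.isCompact_closure).mono_measure (Measure.restrict_mono subset_closure le_rfl)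
  exact AEPeriodic.memLp_ofTorus hf.2 f.aestronglyMeasurable (isUnitCell_fundamentalDomain Y) h1

theorem mem_L2per_of_memLp {f : ScalarField d} (hf : IsPeriodic Y f)
    (h2 : MemLp (fun θ => f (ofTorus Y θ)) 2 (volume : Measure (Torus d))) : f ∈ L2per Y := by
  refine ⟨fun K hK => ?_, hf⟩
  exact (memLp_congr_ae (ae_restrict_of_ae (AEPeriodic.ae_eq hf))).1
    (memLp_comp_toTorus h2 hK.isBounded)

/-- `L²_per` as a submodule. -/
def L2perSubmodule (Y : Module.Basis (Fin d) ℝ (Pt d)) : Submodule ℝ (ScalarField d) where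
  carrier := L2per Y
  add_mem' := by
    intro f g hf hg
    exact ⟨fun K hK => ((hf.1 K hK).add (hg.1 K hK)).ae_eq
        (ae_restrict_of_ae (AEEqFun.coeFn_add f g).symm),
      (AEPeriodic.add hf.2 hg.2).congr (AEEqFun.coeFn_add f g).symm⟩
  zero_mem' :=
    ⟨fun K hK => (MemLp.zero (ε := ℝ)).ae_eq (ae_restrict_of_ae AEEqFun.coeFn_zero.symm),
      (AEPeriodic.const 0).congr AEEqFun.coeFn_zero.symm⟩
  smul_mem' := by
    intro c f hf
    exact ⟨fun K hK => ((hf.1 K hK).const_smul c).ae_eq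
        (ae_restrict_of_ae (AEEqFun.coeFn_smul c f).symm),
      ((AEPeriodic.const c).mul hf.2).congr (AEEqFun.coeFn_smul c f).symm⟩

theorem const_mem_L2per (a : ℝ) : (AEEqFun.const (Pt d) a : ScalarField d) ∈ L2per Y := by
  have h := AEEqFun.coeFn_const (Pt d) a (μ := (volume : Measure (Pt d)))
  refine ⟨fun K hK => ?_, (AEPeriodic.const a).congr h.symm⟩
  have : IsFiniteMeasure ((volume : Measure (Pt d)).restrict K) := ⟨by simpa using hK.measure_lt_top⟩
  exact (memLp_const a).ae_eq (ae_restrict_of_ae h.symm)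

theorem mul_mem_L2per {b f : ScalarField d} (hb : IsPeriodic Y b) {M : ℝ}
    (hM : ∀ᵐ x ∂(volume : Measure (Pt d)), |b x| ≤ M) (hf : f ∈ L2per Y) : b * f ∈ L2per Y := by
  refine ⟨fun K hK => ?_, (AEPeriodic.mul hb hf.2).congr (AEEqFun.coeFn_mul b f).symm⟩
  refine MemLp.ae_eq (ae_restrict_of_ae (AEEqFun.coeFn_mul b f).symm) ?_
  refine (hf.1 K hK).of_le_mul (c := M)
    (b.aestronglyMeasurable.mul f.aestronglyMeasurable).restrict (ae_restrict_of_ae ?_)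
  filter_upwards [hM] with x hx
  rw [Pi.mul_apply, norm_mul]
  exact mul_le_mul_of_nonneg_right hx (norm_nonneg _)

/-! ### Fourier coefficients of periodic functions -/

section Fourier

/-- The Fourier coefficients of a periodic function. -/
def coeff (Y : Module.Basis (Fin d) ℝ (Pt d)) (f : ScalarField d) (k : Fin d → ℤ) : ℂ :=
  UnitAddTorus.mFourierCoeff (fun θ : Torus d => ((f (ofTorus Y θ) : ℝ) : ℂ)) k

theorem memLp_ofReal_ofTorus {f : ScalarField d} (hf : f ∈ L2per Y) :
    MemLp (fun θ => ((f (ofTorus Y θ) : ℝ) : ℂ)) 2 (volume : Measure (Torus d)) :=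
  (memLp_ofTorus_of_mem hf).ofReal

theorem coeff_toLp {f : ScalarField d} (hf : f ∈ L2per Y) (k : Fin d → ℤ) :
    UnitAddTorus.mFourierCoeff ((memLp_ofReal_ofTorus hf).toLp) k = coeff Y f k := by
  refine integral_congr_ae ?_
  filter_upwards [(memLp_ofReal_ofTorus hf).coeFn_toLp] with θ hθ
  rw [hθ]

theorem integrable_mFourier_mul {F : Torus d → ℂ} (hF : MemLp F 2 volume) (k : Fin d → ℤ) :
    Integrable (fun θ => UnitAddTorus.mFourier k θ • F θ) := by
  refine (hF.integrable (by norm_num)).bdd_smul 1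
    (UnitAddTorus.mFourier k).continuous.aestronglyMeasurable (ae_of_all _ fun θ => ?_)
  exact ((UnitAddTorus.mFourier k).norm_coe_le_norm θ).trans UnitAddTorus.mFourier_norm.le

theorem ae_ofTorus {p : Pt d → Prop} (hp : ∀ᵐ x ∂(volume : Measure (Pt d)), p x) :
    ∀ᵐ θ ∂(volume : Measure (Torus d)), p (ofTorus Y θ) :=
  (quasiMeasurePreserving_ofTorus Y).ae hp

theorem coeff_add {f g : ScalarField d} (hf : f ∈ L2per Y) (hg : g ∈ L2per Y)
    (k : Fin d → ℤ) : coeff Y (f + g) k = coeff Y f k + coeff Y g k := by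
  rw [coeff, coeff, coeff, UnitAddTorus.mFourierCoeff, UnitAddTorus.mFourierCoeff,
    UnitAddTorus.mFourierCoeff, ← integral_add (integrable_mFourier_mul (memLp_ofReal_ofTorus hf) _)
    (integrable_mFourier_mul (memLp_ofReal_ofTorus hg) _)]
  refine integral_congr_ae ?_
  filter_upwards [ae_ofTorus (Y := Y) (AEEqFun.coeFn_add f g)] with θ hθ
  rw [hθ, Pi.add_apply, Complex.ofReal_add, smul_add]

theorem coeff_smul (c : ℝ) (f : ScalarField d) (k : Fin d → ℤ) :
    coeff Y (c • f) k = c * coeff Y f k := by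
  rw [coeff, coeff, UnitAddTorus.mFourierCoeff, UnitAddTorus.mFourierCoeff, ← integral_const_mul]
  refine integral_congr_ae ?_
  filter_upwards [ae_ofTorus (Y := Y) (AEEqFun.coeFn_smul c f)] with θ hθ
  simp only [hθ, Pi.smul_apply, smul_eq_mul, Complex.ofReal_mul]
  ring

theorem coeff_zero (k : Fin d → ℤ) : coeff Y (0 : ScalarField d) k = 0 := by
  simpa using coeff_smul (Y := Y) 0 (0 : ScalarField d) k

theorem coeff_sub {f g : ScalarField d} (hf : f ∈ L2per Y) (hg : g ∈ L2per Y)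
    (k : Fin d → ℤ) : coeff Y (f - g) k = coeff Y f k - coeff Y g k := by
  have h := (L2perSubmodule Y).smul_mem (-1 : ℝ) hg
  rw [show f - g = f + (-1 : ℝ) • g by rw [neg_one_smul, sub_eq_add_neg], coeff_add hf h, coeff_smul]
  push_cast
  ring

theorem coeff_sum {ι : Type*} (s : Finset ι) {f : ι → ScalarField d}
    (hf : ∀ i ∈ s, f i ∈ L2per Y) (k : Fin d → ℤ) :
    coeff Y (∑ i ∈ s, f i) k = ∑ i ∈ s, coeff Y (f i) k := by
  classical
  induction s using Finset.induction_on with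
  | empty => simpa using coeff_zero k
  | insert a s ha ih =>
    rw [Finset.sum_insert ha, Finset.sum_insert ha, coeff_add (hf a (Finset.mem_insert_self a s))
      ((L2perSubmodule Y).sum_mem fun i hi => hf i (Finset.mem_insert_of_mem hi)),
      ih fun i hi => hf i (Finset.mem_insert_of_mem hi)]

/-- Parseval's identity on the torus; the conjugate under the integral drops because the fields are
real. -/
theorem hasSum_conj_coeff_mul {f g : ScalarField d} (hf : f ∈ L2per Y) (hg : g ∈ L2per Y) :
    HasSum (fun k => conj (coeff Y f k) * coeff Y g k)
      ((∫ θ, f (ofTorus Y θ) * g (ofTorus Y θ) : ℝ) : ℂ) := by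
  have h : HasSum (fun k => conj (UnitAddTorus.mFourierCoeff (memLp_ofReal_ofTorus hf).toLp k) *
      UnitAddTorus.mFourierCoeff (memLp_ofReal_ofTorus hg).toLp k)
      (∫ θ : Torus d, conj (((memLp_ofReal_ofTorus hf).toLp : Torus d → ℂ) θ) *
        ((memLp_ofReal_ofTorus hg).toLp : Torus d → ℂ) θ) :=
    UnitAddTorus.hasSum_prod_mFourierCoeff (memLp_ofReal_ofTorus hf).toLp
      (memLp_ofReal_ofTorus hg).toLp
  rw [show (fun k => conj (coeff Y f k) * coeff Y g k) = _ from
    funext fun k => by rw [← coeff_toLp hf, ← coeff_toLp hg]]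
  convert h using 1
  rw [← integral_complex_ofReal]
  refine integral_congr_ae ?_
  filter_upwards [(memLp_ofReal_ofTorus hf).coeFn_toLp, (memLp_ofReal_ofTorus hg).coeFn_toLp]
    with θ h1 h2
  rw [h1, h2, Complex.conj_ofReal, Complex.ofReal_mul]

theorem summable_norm_coeff_sq {f : ScalarField d} (hf : f ∈ L2per Y) :
    Summable fun k => ‖coeff Y f k‖ ^ 2 := by
  have h : Summable fun k =>
      ‖UnitAddTorus.mFourierCoeff (memLp_ofReal_ofTorus hf).toLp k‖ ^ 2 :=
    (UnitAddTorus.hasSum_sq_mFourierCoeff (memLp_ofReal_ofTorus hf).toLp).summable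
  exact h.congr fun k => by rw [coeff_toLp hf]

theorem conj_mFourierCoeff (F : Torus d → ℂ) (k : Fin d → ℤ) :
    UnitAddTorus.mFourierCoeff (fun θ => conj (F θ)) k =
      conj (UnitAddTorus.mFourierCoeff F (-k)) := by
  rw [UnitAddTorus.mFourierCoeff, UnitAddTorus.mFourierCoeff, ← integral_conj]
  refine integral_congr_ae (ae_of_all _ fun θ => ?_)
  simp [UnitAddTorus.mFourier_neg]

theorem coeff_neg_index (f : ScalarField d) (k : Fin d → ℤ) :
    coeff Y f (-k) = conj (coeff Y f k) := by
  rw [coeff, coeff, ← neg_neg k, ← conj_mFourierCoeff, neg_neg]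
  simp

/-- Riesz–Fischer gives a complex function on the torus; its real part is pulled back to ℝ^d, and
the Hermitian symmetry `hr` ensures that taking the real part leaves the coefficients unchanged. -/
theorem exists_coeff_eq {a : (Fin d → ℤ) → ℂ} (ha : Summable fun k => ‖a k‖ ^ 2)
    (hr : ∀ k, a (-k) = conj (a k)) : ∃ f ∈ L2per Y, ∀ k, coeff Y f k = a k := by
  have hmem : Memℓp a 2 := memℓp_gen (by simpa using ha)
  let F := UnitAddTorus.mFourierBasis.repr.symm (⟨a, hmem⟩ : lp (fun _ => ℂ) 2)
  have hF : ∀ k, UnitAddTorus.mFourierCoeff F k = a k := by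
    intro k
    rw [← UnitAddTorus.mFourierBasis_repr, LinearIsometryEquiv.apply_symm_apply]
  have hFm : MemLp F 2 (volume : Measure (Torus d)) := Lp.memLp F
  have hmeas : AEStronglyMeasurable (fun x => (F (toTorus Y x)).re) (volume : Measure (Pt d)) :=
    hFm.re.aestronglyMeasurable.comp_quasiMeasurePreserving (quasiMeasurePreserving_toTorus Y)
  let f : ScalarField d := AEEqFun.mk _ hmeas
  have hf : f =ᵐ[volume] fun x => (F (toTorus Y x)).re := AEEqFun.coeFn_mk _ hmeas
  have hfT : ∀ᵐ θ ∂(volume : Measure (Torus d)), f (ofTorus Y θ) = (F θ).re := by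
    filter_upwards [ae_ofTorus (Y := Y) hf] with θ hθ
    rw [hθ, toTorus_ofTorus]
  have hper : IsPeriodic Y f := by
    refine AEPeriodic.congr (h := fun x => (F (toTorus Y x)).re) (fun y hy => ?_) hf.symm
    exact ae_of_all _ fun x => by simp only [toTorus_add_lattice Y x hy]
  refine ⟨f, mem_L2per_of_memLp hper (hFm.re.ae_eq (hfT.mono fun θ h => h.symm)), fun k => ?_⟩
  have h1 : coeff Y f k = UnitAddTorus.mFourierCoeff
      (fun θ => (2⁻¹ : ℂ) * (F θ + conj (F θ))) k := by
    refine integral_congr_ae ?_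
    filter_upwards [hfT] with θ hθ
    rw [hθ, Complex.add_conj]
    push_cast
    simp
  have hc : MemLp (fun θ => conj (F θ)) 2 (volume : Measure (Torus d)) := hFm.star
  have h2 : UnitAddTorus.mFourierCoeff (fun θ => (2⁻¹ : ℂ) * (F θ + conj (F θ))) k =
      2⁻¹ * (UnitAddTorus.mFourierCoeff F k + UnitAddTorus.mFourierCoeff (fun θ => conj (F θ)) k) := by
    simp only [UnitAddTorus.mFourierCoeff]
    rw [← integral_add (integrable_mFourier_mul hFm _) (integrable_mFourier_mul hc _),
      ← integral_const_mul]
    refine integral_congr_ae (ae_of_all _ fun θ => ?_)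
    simp only [smul_eq_mul]
    ring
  rw [h1, h2, conj_mFourierCoeff, hF, hF, hr, Complex.conj_conj]
  ring

end Fourier

/-! ### From compactly supported to periodic test functions -/

theorem locallyIntegrable_of_mem {f : ScalarField d} (hf : f ∈ L2per Y) :
    LocallyIntegrable f volume := by
  refine locallyIntegrable_iff.2 fun K hK => ?_
  have : IsFiniteMeasure ((volume : Measure (Pt d)).restrict K) := ⟨by simpa using hK.measure_lt_top⟩
  exact (hf.1 K hK).integrable (by norm_num)

theorem locallyIntegrable_mul_continuous {h ψ : Pt d → ℝ} (hh : LocallyIntegrable h volume)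
    (hψ : Continuous ψ) : LocallyIntegrable (fun x => h x * ψ x) volume :=
  locallyIntegrable_iff.2 fun _ hK =>
    (hh.integrableOn_isCompact hK).mul_continuousOn hψ.continuousOn hK

theorem AEPeriodic.integral_comp_add {h : Pt d → ℝ} (hh : AEPeriodic Y h) (t : Pt d) :
    ∫ θ, h (ofTorus Y θ + t) = ∫ θ, h (ofTorus Y θ) := by
  rw [← integral_add_right_eq_self (fun θ => h (ofTorus Y θ)) (toTorus Y t)]
  refine integral_congr_ae ?_
  filter_upwards [ae_ofTorus (Y := Y) (ae_shift hh.ae_eq t)] with θ hθ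
  rw [← hθ, toTorus_add, toTorus_ofTorus]

theorem AEPeriodic.comp_add {h : Pt d → ℝ} (hh : AEPeriodic Y h) (t : Pt d) :
    AEPeriodic Y (fun x => h (x + t)) := by
  intro y hy
  filter_upwards [ae_shift (hh y hy) t] with x hx
  rw [← hx]
  congr 1
  abel

theorem AEPeriodic.integral_mul_indicator_sub {h : Pt d → ℝ} (hh : AEPeriodic Y h)
    (hm : AEStronglyMeasurable h volume) (t : Pt d) :
    ∫ x, h x * (ZSpan.fundamentalDomain Y).indicator (fun _ => (1 : ℝ)) (x - t) =
      cellVolume Y * ∫ θ, h (ofTorus Y θ) := by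
  rw [← integral_add_right_eq_self _ t]
  have h1 : ∀ x, h (x + t) * (ZSpan.fundamentalDomain Y).indicator (fun _ => (1 : ℝ)) (x + t - t) =
      (ZSpan.fundamentalDomain Y).indicator (fun x => h (x + t)) x := by
    intro x
    by_cases hx : x ∈ ZSpan.fundamentalDomain Y <;> simp [hx]
  simp_rw [h1]
  rw [integral_indicator (ZSpan.fundamentalDomain_measurableSet Y),
    (hh.comp_add t).setIntegral (hm.comp_measurePreserving (measurePreserving_add_right volume t))
      (isUnitCell_fundamentalDomain Y), hh.integral_comp_add]

/-- The smoothed indicator function of the fundamental cell. -/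
def cutoff (Y : Module.Basis (Fin d) ℝ (Pt d)) (ρ : Pt d → ℝ) : Pt d → ℝ :=
  (ZSpan.fundamentalDomain Y).indicator (fun _ => (1 : ℝ)) ⋆[ContinuousLinearMap.lsmul ℝ ℝ] ρ

/-- By Fubini, the cutoff is a superposition of indicators of translated cells weighted by `ρ`, and
a periodic function has the same integral on each of them. It is used with total weight 1 for a bump
and 0 for its derivatives. -/
theorem AEPeriodic.integral_mul_cutoff {h : Pt d → ℝ} (hh : AEPeriodic Y h)
    (hi : LocallyIntegrable h volume) {ρ : Pt d → ℝ} (hρ : Continuous ρ)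
    (hc : HasCompactSupport ρ) :
    ∫ x, h x * cutoff Y ρ x = (∫ t, ρ t) * (cellVolume Y * ∫ θ, h (ofTorus Y θ)) := by
  set P := ZSpan.fundamentalDomain Y with hP
  have hPm : MeasurableSet P := ZSpan.fundamentalDomain_measurableSet Y
  have hPb : Bornology.IsBounded P := ZSpan.fundamentalDomain_isBounded Y
  -- The integrand vanishes unless the first variable lies in this compact set, so local
  -- integrability of `h` suffices for Fubini.
  let K : Set (Pt d) := closure P + tsupport ρ
  have hK : IsCompact K := hPb.isCompact_closure.add hc
  have hint : Integrable (fun z : Pt d × Pt d =>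
      h z.1 * (P.indicator (fun _ => (1 : ℝ)) (z.1 - z.2) * ρ z.2)) (volume.prod volume) := by
    have h1 : Integrable (K.indicator h) volume :=
      (hi.integrableOn_isCompact hK).integrable_indicator hK.measurableSet
    have h2 : Integrable ρ volume := hρ.integrable_of_hasCompactSupport hc
    have h3 := (h1.mul_prod h2).bdd_mul (c := 1)
      (f := fun z : Pt d × Pt d => P.indicator (fun _ => (1 : ℝ)) (z.1 - z.2))
      (((measurable_const.indicator hPm).comp
        (measurable_fst.sub measurable_snd)).aestronglyMeasurable)
      (ae_of_all _ fun z => by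
        by_cases hz : z.1 - z.2 ∈ P <;> simp [hz])
    refine h3.congr (ae_of_all _ fun z => ?_)
    by_cases hz : z.1 - z.2 ∈ P
    · by_cases hs : ρ z.2 = 0
      · simp [hs]
      · have hzK : z.1 ∈ K :=
          ⟨z.1 - z.2, subset_closure hz, z.2, subset_tsupport _ hs, sub_add_cancel _ _⟩
        simp [hz, hzK]
    · simp [hz]
  have hcut : ∀ x, h x * cutoff Y ρ x =
      ∫ t, h x * (P.indicator (fun _ => (1 : ℝ)) (x - t) * ρ t) := by
    intro x
    rw [integral_const_mul, cutoff, convolution_lsmul_swap]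
    rfl
  simp_rw [hcut]
  rw [integral_integral_swap hint]
  have hin : ∀ t, ∫ x, h x * (P.indicator (fun _ => (1 : ℝ)) (x - t) * ρ t) =
      ρ t * (cellVolume Y * ∫ θ, h (ofTorus Y θ)) := by
    intro t
    rw [← hh.integral_mul_indicator_sub hi.aestronglyMeasurable t, ← integral_const_mul]
    refine integral_congr_ae (ae_of_all _ fun x => ?_)
    simp only [hP]
    ring
  simp_rw [hin]
  rw [integral_mul_const]

theorem locallyIntegrable_indicator_cell :
    LocallyIntegrable ((ZSpan.fundamentalDomain Y).indicator (fun _ => (1 : ℝ))) volume :=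
  (locallyIntegrable_const 1).indicator (ZSpan.fundamentalDomain_measurableSet Y)

theorem contDiff_cutoff {ρ : Pt d → ℝ} (hρ : ContDiff ℝ ∞ ρ) (hc : HasCompactSupport ρ) :
    ContDiff ℝ ∞ (cutoff Y ρ) :=
  hc.contDiff_convolution_right _ locallyIntegrable_indicator_cell hρ

theorem hasCompactSupport_cutoff {ρ : Pt d → ℝ} (hc : HasCompactSupport ρ) :
    HasCompactSupport (cutoff Y ρ) := by
  refine HasCompactSupport.convolution _ ?_ hc
  refine HasCompactSupport.of_support_subset_isCompact
    (ZSpan.fundamentalDomain_isBounded Y).isCompact_closure ?_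
  exact (Set.support_indicator_subset).trans subset_closure

theorem partialDeriv_cutoff {ρ : Pt d → ℝ} (hρ : ContDiff ℝ ∞ ρ) (hc : HasCompactSupport ρ)
    (j : Fin d) (x : Pt d) : partialDeriv j (cutoff Y ρ) x = cutoff Y (partialDeriv j ρ) x := by
  have h1 : ContDiff ℝ 1 ρ := hρ.of_le (by exact_mod_cast le_top)
  have h := hc.hasFDerivAt_convolution_right (ContinuousLinearMap.lsmul ℝ ℝ)
    (locallyIntegrable_indicator_cell (Y := Y)) h1 x
  rw [partialDeriv, cutoff, h.fderiv, convolution_precompR_apply _ locallyIntegrable_indicator_cell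
    (hc.fderiv ℝ) (h1.continuous_fderiv one_ne_zero)]
  rfl

theorem continuous_partialDeriv {φ : Pt d → ℝ} (hφ : ContDiff ℝ ∞ φ) (j : Fin d) :
    Continuous (partialDeriv j φ) :=
  (hφ.continuous_fderiv (by simp)).clm_apply continuous_const

theorem hasCompactSupport_partialDeriv {φ : Pt d → ℝ} (hc : HasCompactSupport φ) (j : Fin d) :
    HasCompactSupport (partialDeriv j φ) :=
  hc.fderiv_apply ℝ _

theorem integral_partialDeriv {φ : Pt d → ℝ} (hφ : ContDiff ℝ ∞ φ) (hc : HasCompactSupport φ)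
    (j : Fin d) : ∫ x, partialDeriv j φ x = 0 := by
  have hi := (continuous_partialDeriv hφ j).integrable_of_hasCompactSupport (μ := volume)
    (hasCompactSupport_partialDeriv hc j)
  have h := integral_mul_fderiv_eq_neg_fderiv_mul_of_integrable (μ := (volume : Measure (Pt d)))
    (f := fun _ => (1 : ℝ)) (g := φ) (v := EuclideanSpace.single j 1) (by simp)
    (by simpa using! hi)
    (by simpa using hφ.continuous.integrable_of_hasCompactSupport hc)
    (fun _ _ => differentiableAt_const _) (fun x _ => (hφ.differentiable (by simp)) x)
  simpa using! h

/-- A weak divergence identity on `ℝ^d` between periodic fields may be tested with smooth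
periodic functions. -/
theorem sum_integral_mul_partialDeriv_of_weak {s : Fin d → ScalarField d} {g : ScalarField d}
    (hs : ∀ j, s j ∈ L2per Y) (hg : g ∈ L2per Y)
    (hw : ∀ φ : Pt d → ℝ, ContDiff ℝ ∞ φ → HasCompactSupport φ →
      ∑ j, ∫ x, s j x * partialDeriv j φ x = -∫ x, g x * φ x)
    {ψ : Pt d → ℝ} (hψ : ContDiff ℝ ∞ ψ) (hp : AEPeriodic Y ψ)
    (hp' : ∀ j, AEPeriodic Y (partialDeriv j ψ)) :
    ∑ j, ∫ θ, s j (ofTorus Y θ) * partialDeriv j ψ (ofTorus Y θ) =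
      -∫ θ, g (ofTorus Y θ) * ψ (ofTorus Y θ) := by
  let b : ContDiffBump (0 : Pt d) := default
  let ρ : Pt d → ℝ := b.normed volume
  have hρ : ContDiff ℝ ∞ ρ := b.contDiff_normed
  have hc : HasCompactSupport ρ := b.hasCompactSupport_normed
  have hρ1 : ∫ x, ρ x = 1 := b.integral_normed
  have hχ := contDiff_cutoff (Y := Y) hρ hc
  have hχc := hasCompactSupport_cutoff (Y := Y) hc
  -- A periodic `ψ` has no compact support; it is localized by the smoothed cell, whose lattice
  -- translates sum to one.
  have h := hw (fun x => cutoff Y ρ x * ψ x) (hχ.mul hψ) hχc.mul_right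
  have hder : ∀ j x, partialDeriv j (fun x => cutoff Y ρ x * ψ x) x =
      partialDeriv j ψ x * cutoff Y ρ x + ψ x * cutoff Y (partialDeriv j ρ) x := by
    intro j x
    rw [← partialDeriv_cutoff hρ hc]
    have h1 := (hχ.differentiable (by simp)) x
    have h2 := (hψ.differentiable (by simp)) x
    rw [partialDeriv, fderiv_fun_mul h1 h2]
    simp only [partialDeriv, add_apply, smul_apply, smul_eq_mul]
    ring
  have hterm : ∀ j, ∫ x, s j x * partialDeriv j (fun x => cutoff Y ρ x * ψ x) x =
      cellVolume Y * ∫ θ, s j (ofTorus Y θ) * partialDeriv j ψ (ofTorus Y θ) := by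
    intro j
    have l1 := locallyIntegrable_mul_continuous (locallyIntegrable_of_mem (hs j))
      (continuous_partialDeriv hψ j)
    have l2 := locallyIntegrable_mul_continuous (locallyIntegrable_of_mem (hs j)) hψ.continuous
    have i1 := AEPeriodic.integral_mul_cutoff ((AEPeriodic.mul (hs j).2 (hp' j))) l1 hρ.continuous hc
    have i2 := AEPeriodic.integral_mul_cutoff ((AEPeriodic.mul (hs j).2 hp)) l2
      (continuous_partialDeriv hρ j) (hasCompactSupport_partialDeriv hc j)
    -- The term where the derivative falls on the cutoff vanishes, because the derivative of `ρ` has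
    -- zero integral.
    rw [integral_partialDeriv hρ hc, zero_mul] at i2
    rw [hρ1, one_mul] at i1
    rw [← i1, ← add_zero (∫ x, _ * cutoff Y ρ x), ← i2, ← integral_add]
    · refine integral_congr_ae (ae_of_all _ fun x => ?_)
      simp only [hder]
      ring
    · exact l1.integrable_smul_right_of_hasCompactSupport hχ.continuous hχc
    · have e : cutoff Y (partialDeriv j ρ) = partialDeriv j (cutoff Y ρ) :=
        funext fun x => (partialDeriv_cutoff hρ hc j x).symm
      rw [e]
      exact l2.integrable_smul_right_of_hasCompactSupport (continuous_partialDeriv hχ j)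
        (hasCompactSupport_partialDeriv hχc j)
  have hg' : ∫ x, g x * (cutoff Y ρ x * ψ x) =
      cellVolume Y * ∫ θ, g (ofTorus Y θ) * ψ (ofTorus Y θ) := by
    have i1 := AEPeriodic.integral_mul_cutoff (AEPeriodic.mul hg.2 hp)
      (locallyIntegrable_mul_continuous (locallyIntegrable_of_mem hg) hψ.continuous)
      hρ.continuous hc
    rw [hρ1, one_mul] at i1
    rw [← i1]
    refine integral_congr_ae (ae_of_all _ fun x => ?_)
    simp only
    ring
  simp_rw [hterm] at h
  rw [hg', ← Finset.mul_sum, ← mul_neg] at h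
  exact mul_left_cancel₀ (by exact_mod_cast cellVolume_ne_zero Y) h

/-! ### Plane waves and weak derivatives in Fourier space -/

/-- The components of the wave vector with integer coordinates `k` in the dual basis. -/
def waveVec (Y : Module.Basis (Fin d) ℝ (Pt d)) (k : Fin d → ℤ) (j : Fin d) : ℝ :=
  ∑ i, k i * Y.repr (EuclideanSpace.single j 1) i

/-- The phase `2π k · x` as a continuous linear form. -/
def phase (Y : Module.Basis (Fin d) ℝ (Pt d)) (k : Fin d → ℤ) : Pt d →L[ℝ] ℝ :=
  LinearMap.toContinuousLinearMap ((2 * Real.pi) • ∑ i, (k i : ℝ) • Y.coord i)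

theorem phase_apply (k : Fin d → ℤ) (x : Pt d) :
    phase Y k x = 2 * Real.pi * ∑ i, k i * Y.repr x i := by
  simp [phase]

theorem phase_single (k : Fin d → ℤ) (j : Fin d) :
    phase Y k (EuclideanSpace.single j 1) = 2 * Real.pi * waveVec Y k j := by
  rw [phase_apply, waveVec]

theorem mFourier_toTorus (k : Fin d → ℤ) (x : Pt d) :
    UnitAddTorus.mFourier k (toTorus Y x) = Complex.exp (Complex.I * (phase Y k x : ℝ)) := by
  simp only [UnitAddTorus.mFourier, toTorus, ContinuousMap.coe_mk, fourier_coe_apply, phase_apply]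
  rw [← Complex.exp_sum]
  congr 1
  push_cast
  rw [Finset.mul_sum, Finset.mul_sum]
  refine Finset.sum_congr rfl fun i _ => ?_
  ring

theorem mFourier_toTorus_eq (k : Fin d → ℤ) (x : Pt d) :
    UnitAddTorus.mFourier k (toTorus Y x) =
      (Real.cos (phase Y k x) : ℂ) + (Real.sin (phase Y k x) : ℂ) * Complex.I := by
  rw [mFourier_toTorus, mul_comm, Complex.exp_mul_I, Complex.ofReal_cos, Complex.ofReal_sin]

theorem mFourier_toTorus_periodic (k : Fin d → ℤ) (x : Pt d) {y : Pt d} (hy : y ∈ lattice Y) :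
    Real.cos (phase Y k (x + y)) = Real.cos (phase Y k x) ∧
      Real.sin (phase Y k (x + y)) = Real.sin (phase Y k x) := by
  have h : UnitAddTorus.mFourier k (toTorus Y (x + y)) = UnitAddTorus.mFourier k (toTorus Y x) := by
    rw [toTorus_add_lattice Y x hy]
  rw [mFourier_toTorus_eq, mFourier_toTorus_eq] at h
  have h1 := congrArg Complex.re h
  have h2 := congrArg Complex.im h
  simp only [Complex.add_re, Complex.add_im, Complex.mul_re, Complex.mul_im, Complex.ofReal_re,
    Complex.ofReal_im, Complex.I_re, Complex.I_im, mul_zero, mul_one, sub_zero, add_zero,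
    zero_add] at h1 h2
  exact ⟨h1, h2⟩

theorem partialDeriv_cos_phase (k : Fin d → ℤ) (j : Fin d) (x : Pt d) :
    partialDeriv j (fun x => Real.cos (phase Y k x)) x =
      -(2 * Real.pi * waveVec Y k j) * Real.sin (phase Y k x) := by
  have h := ((phase Y k).hasFDerivAt (x := x)).cos
  rw [partialDeriv, h.fderiv, smul_apply, phase_single, smul_eq_mul]
  ring

theorem partialDeriv_sin_phase (k : Fin d → ℤ) (j : Fin d) (x : Pt d) :
    partialDeriv j (fun x => Real.sin (phase Y k x)) x =
      (2 * Real.pi * waveVec Y k j) * Real.cos (phase Y k x) := by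
  have h := ((phase Y k).hasFDerivAt (x := x)).sin
  rw [partialDeriv, h.fderiv, smul_apply, phase_single, smul_eq_mul]
  ring

theorem aePeriodic_cos_phase (k : Fin d → ℤ) : AEPeriodic Y fun x => Real.cos (phase Y k x) :=
  fun _ hy => ae_of_all _ fun x => (mFourier_toTorus_periodic k x hy).1

theorem aePeriodic_sin_phase (k : Fin d → ℤ) : AEPeriodic Y fun x => Real.sin (phase Y k x) :=
  fun _ hy => ae_of_all _ fun x => (mFourier_toTorus_periodic k x hy).2

theorem integrable_mul_trig {f : ScalarField d} (hf : f ∈ L2per Y) {u : ℝ → ℝ} (hu : Continuous u)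
    (h1 : ∀ t, |u t| ≤ 1) (k : Fin d → ℤ) :
    Integrable (fun θ => f (ofTorus Y θ) * u (phase Y k (ofTorus Y θ)))
      (volume : Measure (Torus d)) :=
  ((memLp_ofTorus_of_mem hf).integrable (by norm_num)).mul_bdd (c := 1)
    ((hu.comp (phase Y k).continuous).measurable.comp (measurable_ofTorus Y)).aestronglyMeasurable
    (ae_of_all _ fun _ => h1 _)

theorem coeff_eq_cos_sin {f : ScalarField d} (hf : f ∈ L2per Y) (k : Fin d → ℤ) :
    coeff Y f k =
      ((∫ θ, f (ofTorus Y θ) * Real.cos (phase Y k (ofTorus Y θ)) : ℝ) : ℂ) -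
      ((∫ θ, f (ofTorus Y θ) * Real.sin (phase Y k (ofTorus Y θ)) : ℝ) : ℂ) * Complex.I := by
  rw [← integral_complex_ofReal, ← integral_complex_ofReal, ← integral_mul_const, ← integral_sub]
  · refine integral_congr_ae (ae_of_all _ fun θ => ?_)
    have h := mFourier_toTorus_eq (Y := Y) k (ofTorus Y θ)
    rw [toTorus_ofTorus] at h
    simp only [UnitAddTorus.mFourier_neg, h, smul_eq_mul, map_add, map_mul, Complex.conj_ofReal,
      Complex.conj_I]
    push_cast
    ring
  · exact (integrable_mul_trig hf Real.continuous_cos Real.abs_cos_le_one k).ofReal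
  · exact (integrable_mul_trig hf Real.continuous_sin Real.abs_sin_le_one k).ofReal.mul_const _

/-- Test functions are real, so the real and imaginary parts of the plane wave are tested separately
and then recombined. -/
theorem coeff_eq_of_weak {s : Fin d → ScalarField d} {g : ScalarField d}
    (hs : ∀ j, s j ∈ L2per Y) (hg : g ∈ L2per Y)
    (hw : ∀ φ : Pt d → ℝ, ContDiff ℝ ∞ φ → HasCompactSupport φ →
      ∑ j, ∫ x, s j x * partialDeriv j φ x = -∫ x, g x * φ x) (k : Fin d → ℤ) :
    coeff Y g k = ∑ j, (2 * Real.pi * Complex.I * waveVec Y k j) * coeff Y (s j) k := by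
  have hc := sum_integral_mul_partialDeriv_of_weak hs hg hw
    (ψ := fun x => Real.cos (phase Y k x)) (phase Y k).contDiff.cos (aePeriodic_cos_phase k)
    (fun j => by
      simp only [funext (partialDeriv_cos_phase (Y := Y) k j)]
      exact (AEPeriodic.const _).mul (aePeriodic_sin_phase k))
  have hsn := sum_integral_mul_partialDeriv_of_weak hs hg hw
    (ψ := fun x => Real.sin (phase Y k x)) (phase Y k).contDiff.sin (aePeriodic_sin_phase k)
    (fun j => by
      simp only [funext (partialDeriv_sin_phase (Y := Y) k j)]
      exact (AEPeriodic.const _).mul (aePeriodic_cos_phase k))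
  simp only [partialDeriv_cos_phase, partialDeriv_sin_phase, neg_mul, mul_neg, integral_neg,
    mul_left_comm _ (2 * Real.pi * waveVec Y k _) _, integral_const_mul] at hc hsn
  simp only [coeff_eq_cos_sin hg, fun j => coeff_eq_cos_sin (hs j)]
  have e1 : (∫ θ, g (ofTorus Y θ) * Real.cos (phase Y k (ofTorus Y θ))) =
      ∑ j, 2 * Real.pi * waveVec Y k j *
        ∫ θ, s j (ofTorus Y θ) * Real.sin (phase Y k (ofTorus Y θ)) := by
    rw [Finset.sum_neg_distrib] at hc
    exact (neg_injective hc).symm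
  have e2 : (∫ θ, g (ofTorus Y θ) * Real.sin (phase Y k (ofTorus Y θ))) =
      -∑ j, 2 * Real.pi * waveVec Y k j *
        ∫ θ, s j (ofTorus Y θ) * Real.cos (phase Y k (ofTorus Y θ)) := by
    rw [hsn, neg_neg]
  rw [e1, e2]
  push_cast
  rw [neg_mul, sub_neg_eq_add, Finset.sum_mul, ← Finset.sum_add_distrib]
  refine Finset.sum_congr rfl fun j _ => ?_
  linear_combination ((2 * Real.pi * waveVec Y k j : ℂ) *
    ((∫ θ, s j (ofTorus Y θ) * Real.sin (phase Y k (ofTorus Y θ)) : ℝ) : ℂ)) * Complex.I_sq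

/-- Integration against a compactly supported function, as a continuous functional on the `L²`
space of the torus. -/
theorem exists_clm_integral_mul (Y : Module.Basis (Fin d) ℝ (Pt d)) {φ : Pt d → ℝ} (hφ : Continuous φ) (hc : HasCompactSupport φ) :
    ∃ T : Lp ℂ 2 (volume : Measure (Torus d)) →L[ℂ] ℂ,
      ∀ F, T F = ∫ x, F (toTorus Y x) * (φ x : ℂ) := by
  obtain ⟨C, hC⟩ := exists_map_toTorus_le Y hc.isCompact.isBounded
  obtain ⟨M, hM⟩ := hφ.bounded_above_of_compact_support hc
  have hM0 : 0 ≤ M := (norm_nonneg _).trans (hM 0)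
  have hq := quasiMeasurePreserving_toTorus Y
  have hmeas : ∀ F : Lp ℂ 2 (volume : Measure (Torus d)),
      AEStronglyMeasurable (fun x => F (toTorus Y x) * (φ x : ℂ)) (volume : Measure (Pt d)) :=
    fun F => ((Lp.aestronglyMeasurable F).comp_quasiMeasurePreserving hq).mul
      (Complex.continuous_ofReal.comp hφ).aestronglyMeasurable
  -- The function `φ` is bounded by `M`, its support covers the torus with multiplicity controlled
  -- by `C`, and the L¹ norm is at most the L² norm for a probability measure.
  have hbound : ∀ F : Lp ℂ 2 (volume : Measure (Torus d)),
      ∫⁻ x, ‖F (toTorus Y x) * (φ x : ℂ)‖ₑ ≤ ENNReal.ofReal M * (C * ‖F‖ₑ) := by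
    intro F
    have hsupp : ∀ x, ‖F (toTorus Y x) * (φ x : ℂ)‖ₑ ≤
        (tsupport φ).indicator (fun x => ENNReal.ofReal M * ‖F (toTorus Y x)‖ₑ) x := by
      intro x
      by_cases hx : x ∈ tsupport φ
      · rw [Set.indicator_of_mem hx, enorm_mul, mul_comm]
        gcongr
        rw [← ofReal_norm, Complex.norm_real]
        exact ENNReal.ofReal_le_ofReal (hM x)
      · simp [image_eq_zero_of_notMem_tsupport hx]
    have hFm : AEMeasurable (fun θ => ‖F θ‖ₑ) (volume : Measure (Torus d)) :=
      (Lp.aestronglyMeasurable F).enorm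
    have hFm' : AEMeasurable (fun θ => ‖F θ‖ₑ)
        (Measure.map (toTorus Y) (volume.restrict (tsupport φ))) :=
      hFm.mono_ac ((Measure.absolutelyContinuous_of_le hC).trans
        (Measure.smul_absolutelyContinuous))
    calc ∫⁻ x, ‖F (toTorus Y x) * (φ x : ℂ)‖ₑ
        ≤ ∫⁻ x in tsupport φ, ENNReal.ofReal M * ‖F (toTorus Y x)‖ₑ := by
          rw [← lintegral_indicator (isClosed_tsupport φ).measurableSet]
          exact lintegral_mono hsupp
      _ = ENNReal.ofReal M * ∫⁻ x in tsupport φ, ‖F (toTorus Y x)‖ₑ :=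
          lintegral_const_mul' _ _ ENNReal.ofReal_ne_top
      _ = ENNReal.ofReal M *
            ∫⁻ θ, ‖F θ‖ₑ ∂(Measure.map (toTorus Y) (volume.restrict (tsupport φ))) := by
          rw [lintegral_map' hFm' (measurable_toTorus Y).aemeasurable]
      _ ≤ ENNReal.ofReal M * (C * ∫⁻ θ, ‖F θ‖ₑ) := by
          gcongr
          refine (lintegral_mono' hC le_rfl).trans_eq ?_
          rw [ENNReal.smul_def, lintegral_smul_measure, smul_eq_mul]
      _ ≤ ENNReal.ofReal M * (C * ‖F‖ₑ) := by
          gcongr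
          rw [← eLpNorm_one_eq_lintegral_enorm, Lp.enorm_def]
          exact eLpNorm_le_eLpNorm_of_exponent_le (by norm_num) (Lp.aestronglyMeasurable F)
  have hint : ∀ F : Lp ℂ 2 (volume : Measure (Torus d)),
      Integrable (fun x => F (toTorus Y x) * (φ x : ℂ)) (volume : Measure (Pt d)) := by
    intro F
    refine ⟨hmeas F, (hbound F).trans_lt ?_⟩
    exact ENNReal.mul_lt_top ENNReal.ofReal_lt_top (ENNReal.mul_lt_top ENNReal.coe_lt_top
      enorm_lt_top)
  let T : Lp ℂ 2 (volume : Measure (Torus d)) →ₗ[ℂ] ℂ :=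
    { toFun := fun F => ∫ x, F (toTorus Y x) * (φ x : ℂ)
      map_add' := by
        intro F G
        rw [← integral_add (hint F) (hint G)]
        refine integral_congr_ae ?_
        filter_upwards [hq.ae (Lp.coeFn_add F G)] with x hx
        rw [hx, Pi.add_apply, add_mul]
      map_smul' := by
        intro c F
        rw [RingHom.id_apply, smul_eq_mul, ← integral_const_mul]
        refine integral_congr_ae ?_
        filter_upwards [hq.ae (Lp.coeFn_smul c F)] with x hx
        rw [hx, Pi.smul_apply, smul_eq_mul, mul_assoc] }
  refine ⟨T.mkContinuous (M * C) fun F => ?_, fun F => rfl⟩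
  have h := (enorm_integral_le_lintegral_enorm _).trans (hbound F)
  have h2 : ENNReal.ofReal ‖T F‖ ≤ ENNReal.ofReal (M * C * ‖F‖) := by
    rw [ofReal_norm, ENNReal.ofReal_mul (by positivity), ENNReal.ofReal_mul hM0,
      ofReal_norm, ENNReal.ofReal_coe_nnreal, mul_assoc]
    exact h
  exact (ENNReal.ofReal_le_ofReal_iff (by positivity)).1 h2

/-- The Fourier series converges in L², where integration against `φ` is continuous, so it may be
tested term by term. -/
theorem hasSum_integral_mul {f : ScalarField d} (hf : f ∈ L2per Y) {φ : Pt d → ℝ}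
    (hφ : Continuous φ) (hc : HasCompactSupport φ) :
    HasSum (fun k => coeff Y f k * ∫ x, UnitAddTorus.mFourier k (toTorus Y x) * (φ x : ℂ))
      ((∫ x, f x * φ x : ℝ) : ℂ) := by
  obtain ⟨T, hT⟩ := exists_clm_integral_mul Y hφ hc
  have hq := quasiMeasurePreserving_toTorus Y
  let F := (memLp_ofReal_ofTorus hf).toLp
  have h : HasSum (fun k => UnitAddTorus.mFourierCoeff F k • UnitAddTorus.mFourierLp 2 k) F :=
    UnitAddTorus.hasSum_mFourier_series_L2 F
  have h2 := T.hasSum h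
  convert h2 using 1
  · funext k
    rw [map_smul, coeff_toLp hf, hT, smul_eq_mul]
    congr 1
    refine integral_congr_ae ?_
    filter_upwards [hq.ae (UnitAddTorus.coeFn_mFourierLp (d := Fin d) 2 k)] with x hx
    rw [hx]
  · rw [hT, ← integral_complex_ofReal]
    refine integral_congr_ae ?_
    filter_upwards [hq.ae (memLp_ofReal_ofTorus hf).coeFn_toLp, AEPeriodic.ae_eq hf.2] with x hx h2
    rw [hx, h2, Complex.ofReal_mul]

theorem integral_mFourier_mul_partialDeriv (k : Fin d → ℤ) {φ : Pt d → ℝ} (hφ : ContDiff ℝ ∞ φ)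
    (hc : HasCompactSupport φ) (j : Fin d) :
    ∫ x, UnitAddTorus.mFourier k (toTorus Y x) * (partialDeriv j φ x : ℂ) =
      -(2 * Real.pi * Complex.I * waveVec Y k j) *
        ∫ x, UnitAddTorus.mFourier k (toTorus Y x) * (φ x : ℂ) := by
  have hE : ∀ x, HasFDerivAt (fun x => UnitAddTorus.mFourier k (toTorus Y x))
      (Complex.exp (Complex.I * (phase Y k x : ℝ)) •
        (Complex.I • Complex.ofRealCLM.comp (phase Y k))) x := by
    intro x
    simp only [mFourier_toTorus]
    exact ((Complex.ofRealCLM.hasFDerivAt.comp x (phase Y k).hasFDerivAt).const_mul Complex.I).cexp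
  have hEc : Continuous fun x => UnitAddTorus.mFourier k (toTorus Y x) :=
    (UnitAddTorus.mFourier k).continuous.comp (continuous_toTorus Y)
  have hφC : ∀ x, HasFDerivAt (fun x => (φ x : ℂ)) (Complex.ofRealCLM.comp (fderiv ℝ φ x)) x :=
    fun x => Complex.ofRealCLM.hasFDerivAt.comp x ((hφ.differentiable (by simp)) x).hasFDerivAt
  have hdE : ∀ x, fderiv ℝ (fun x => UnitAddTorus.mFourier k (toTorus Y x)) x
      (EuclideanSpace.single j 1) =
      (2 * Real.pi * Complex.I * waveVec Y k j) * UnitAddTorus.mFourier k (toTorus Y x) := by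
    intro x
    rw [(hE x).fderiv, mFourier_toTorus]
    simp only [smul_apply, ContinuousLinearMap.comp_apply, phase_single, smul_eq_mul,
      Complex.ofRealCLM_apply]
    push_cast
    ring
  have hint : ∀ u : Pt d → ℝ, Continuous u → HasCompactSupport u →
      Integrable (fun x => UnitAddTorus.mFourier k (toTorus Y x) * (u x : ℂ)) volume := by
    intro u hu hcu
    refine (hEc.mul (Complex.continuous_ofReal.comp hu)).integrable_of_hasCompactSupport ?_
    exact HasCompactSupport.mul_left (hcu.comp_left Complex.ofReal_zero)
  have h := integral_mul_fderiv_eq_neg_fderiv_mul_of_integrable (μ := (volume : Measure (Pt d)))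
    (f := fun x => UnitAddTorus.mFourier k (toTorus Y x)) (g := fun x => (φ x : ℂ))
    (v := EuclideanSpace.single j 1)
    (by
      simp only [hdE, mul_assoc]
      exact (((hint φ hφ.continuous hc).const_mul _).const_mul _).const_mul _ |>.const_mul _)
    (by
      simp only [fun x => (hφC x).fderiv]
      exact hint _ (continuous_partialDeriv hφ j) (hasCompactSupport_partialDeriv hc j))
    (hint φ hφ.continuous hc) (fun x _ => (hE x).differentiableAt)
    (fun x _ => (hφC x).differentiableAt)
  simp only [fun x => (hφC x).fderiv, hdE] at h
  simp only [mul_assoc _ (UnitAddTorus.mFourier k _), integral_const_mul] at h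
  rw [neg_mul]
  exact h

/-- Both sides expand in Fourier series that agree term by term once each plane wave is integrated
by parts. -/
theorem weak_of_coeff_eq {s : Fin d → ScalarField d} {g : ScalarField d}
    (hs : ∀ j, s j ∈ L2per Y) (hg : g ∈ L2per Y)
    (h : ∀ k, coeff Y g k = ∑ j, (2 * Real.pi * Complex.I * waveVec Y k j) * coeff Y (s j) k)
    {φ : Pt d → ℝ} (hφ : ContDiff ℝ ∞ φ) (hc : HasCompactSupport φ) :
    ∑ j, ∫ x, s j x * partialDeriv j φ x = -∫ x, g x * φ x := by
  have h1 := hasSum_sum (s := Finset.univ) fun j _ => hasSum_integral_mul (hs j)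
    (continuous_partialDeriv hφ j) (hasCompactSupport_partialDeriv hc j)
  have h2 := (hasSum_integral_mul hg hφ.continuous hc).neg
  have h3 := h1.unique (h2.congr_fun fun k => ?_)
  · exact_mod_cast h3
  · rw [h k, Finset.sum_mul, ← Finset.sum_neg_distrib]
    refine Finset.sum_congr rfl fun j _ => ?_
    rw [integral_mFourier_mul_partialDeriv k hφ hc]
    ring

/-- A periodic field has a given weak divergence if and only if the identity holds for the
Fourier coefficients. -/
theorem weak_divergence_iff {s : Fin d → ScalarField d} {g : ScalarField d}
    (hs : ∀ j, s j ∈ L2per Y) (hg : g ∈ L2per Y) :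
    (∀ φ : Pt d → ℝ, ContDiff ℝ ∞ φ → HasCompactSupport φ →
      ∑ j, ∫ x, s j x * partialDeriv j φ x = -∫ x, g x * φ x) ↔
    ∀ k, coeff Y g k = ∑ j, (2 * Real.pi * Complex.I * waveVec Y k j) * coeff Y (s j) k :=
  ⟨fun h => coeff_eq_of_weak hs hg h, fun h _ hφ hc => weak_of_coeff_eq hs hg h hφ hc⟩

/-- A partial derivative is the divergence of the vector field whose only component is `f`, in
position `j`. -/
theorem isWeakPartial_iff {j : Fin d} {f g : ScalarField d} (hf : f ∈ L2per Y)
    (hg : g ∈ L2per Y) :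
    IsWeakPartial j f g ↔
      ∀ k, coeff Y g k = (2 * Real.pi * Complex.I * waveVec Y k j) * coeff Y f k := by
  have hs : ∀ i, (Pi.single j f : Fin d → ScalarField d) i ∈ L2per Y := by
    intro i
    by_cases hi : i = j
    · subst hi; simpa using hf
    · rw [Pi.single_eq_of_ne hi]; exact (L2perSubmodule Y).zero_mem
  have h := weak_divergence_iff hs hg
  have e1 : ∀ k, ∑ i, (2 * Real.pi * Complex.I * waveVec Y k i) *
      coeff Y ((Pi.single j f : Fin d → ScalarField d) i) k =
      (2 * Real.pi * Complex.I * waveVec Y k j) * coeff Y f k := by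
    intro k
    rw [Finset.sum_eq_single j (fun i _ hi => by rw [Pi.single_eq_of_ne hi, coeff_zero, mul_zero])
      (by simp), Pi.single_eq_same]
  have e2 : ∀ φ : Pt d → ℝ, ∑ i, ∫ x, (Pi.single j f : Fin d → ScalarField d) i x *
      partialDeriv i φ x = ∫ x, f x * partialDeriv j φ x := by
    intro φ
    rw [Finset.sum_eq_single j (fun i _ hi => ?_) (by simp), Pi.single_eq_same]
    rw [Pi.single_eq_of_ne hi, integral_eq_zero_of_ae]
    filter_upwards [AEEqFun.coeFn_zero (α := Pt d) (β := ℝ) (μ := volume)] with x hx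
    rw [hx]; simp
  simp_rw [e1, e2] at h
  exact h

/-! ### Linear structure of the spaces of fields -/

theorem uniformField_mem {A : Matrix (Fin d) (Fin d) ℝ} (hA : A.IsSymm) :
    uniformField A ∈ SymL2per Y := by
  refine ⟨fun i j => ?_, fun i j => const_mem_L2per _⟩
  rw [uniformField, uniformField, ← hA.apply i j]

/-- The symmetric periodic tensor fields as a submodule. -/
def symSubmodule (Y : Module.Basis (Fin d) ℝ (Pt d)) : Submodule ℝ (TensorField d) where
  carrier := SymL2per Y
  add_mem' := fun hf hg =>
    ⟨fun i j => congrArg₂ (· + ·) (hf.1 i j) (hg.1 i j),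
      fun i j => (L2perSubmodule Y).add_mem (hf.2 i j) (hg.2 i j)⟩
  zero_mem' := ⟨fun _ _ => rfl, fun _ _ => (L2perSubmodule Y).zero_mem⟩
  smul_mem' := fun c _ hf =>
    ⟨fun i j => congrArg (c • ·) (hf.1 i j), fun i j => (L2perSubmodule Y).smul_mem c (hf.2 i j)⟩

theorem IsH1perWithGradient.add {f f' : ScalarField d} {G G' : Fin d → ScalarField d}
    (h : IsH1perWithGradient Y f G) (h' : IsH1perWithGradient Y f' G') :
    IsH1perWithGradient Y (f + f') (G + G') := by
  have hf := (L2perSubmodule Y).add_mem h.1 h'.1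
  refine ⟨hf, fun j => ?_⟩
  have hg := (L2perSubmodule Y).add_mem (h.2 j).1 (h'.2 j).1
  refine ⟨hg, (isWeakPartial_iff hf hg).2 fun k => ?_⟩
  rw [coeff_add h.1 h'.1, coeff_add (h.2 j).1 (h'.2 j).1,
    (isWeakPartial_iff h.1 (h.2 j).1).1 (h.2 j).2, (isWeakPartial_iff h'.1 (h'.2 j).1).1 (h'.2 j).2]
  ring

theorem IsH1perWithGradient.smul (c : ℝ) {f : ScalarField d} {G : Fin d → ScalarField d}
    (h : IsH1perWithGradient Y f G) : IsH1perWithGradient Y (c • f) (c • G) := by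
  have hf := (L2perSubmodule Y).smul_mem c h.1
  refine ⟨hf, fun j => ?_⟩
  have hg := (L2perSubmodule Y).smul_mem c (h.2 j).1
  refine ⟨hg, (isWeakPartial_iff hf hg).2 fun k => ?_⟩
  rw [coeff_smul, coeff_smul, (isWeakPartial_iff h.1 (h.2 j).1).1 (h.2 j).2]
  ring

theorem IsH1perWithGradient.zero : IsH1perWithGradient Y (0 : ScalarField d) 0 := by
  have h0 : (0 : ScalarField d) ∈ L2per Y := (L2perSubmodule Y).zero_mem
  exact ⟨h0, fun j => ⟨h0, (isWeakPartial_iff h0 h0).2 fun k => by simp [coeff_zero]⟩⟩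

/-- `E₀` as a submodule. -/
def strainSubmodule (Y : Module.Basis (Fin d) ℝ (Pt d)) : Submodule ℝ (TensorField d) where
  carrier := E₀ Y
  add_mem' := by
    rintro e e' ⟨he, w, G, hw, h⟩ ⟨he', w', G', hw', h'⟩
    refine ⟨(symSubmodule Y).add_mem he he', w + w', G + G', fun i => (hw i).add (hw' i),
      fun i j => ?_⟩
    simp only [Pi.add_apply, h, h']
    module
  zero_mem' := ⟨(symSubmodule Y).zero_mem, 0, 0, fun _ => IsH1perWithGradient.zero,
    fun i j => by simp⟩
  smul_mem' := by
    rintro c e ⟨he, w, G, hw, h⟩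
    refine ⟨(symSubmodule Y).smul_mem c he, c • w, c • G, fun i => (hw i).smul c, fun i j => ?_⟩
    simp only [Pi.smul_apply, h]
    module

/-! ### The duality product -/

/-- The average of a product of two periodic functions. -/
def meanMul (Y : Module.Basis (Fin d) ℝ (Pt d)) (f g : ScalarField d) : ℝ :=
  ∫ θ, f (ofTorus Y θ) * g (ofTorus Y θ)

theorem integrable_mul_ofTorus {f g : ScalarField d} (hf : f ∈ L2per Y) (hg : g ∈ L2per Y) :
    Integrable (fun θ => f (ofTorus Y θ) * g (ofTorus Y θ)) (volume : Measure (Torus d)) :=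
  (memLp_ofTorus_of_mem hf).integrable_mul (memLp_ofTorus_of_mem hg)

theorem meanMul_comm (f g : ScalarField d) : meanMul Y f g = meanMul Y g f := by
  simp only [meanMul, mul_comm]

theorem meanMul_add_left {f f' g : ScalarField d} (hf : f ∈ L2per Y) (hf' : f' ∈ L2per Y)
    (hg : g ∈ L2per Y) : meanMul Y (f + f') g = meanMul Y f g + meanMul Y f' g := by
  rw [meanMul, meanMul, meanMul, ← integral_add (integrable_mul_ofTorus hf hg)
    (integrable_mul_ofTorus hf' hg)]
  refine integral_congr_ae ?_
  filter_upwards [ae_ofTorus (Y := Y) (AEEqFun.coeFn_add f f')] with θ hθ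
  rw [hθ, Pi.add_apply, add_mul]

theorem meanMul_smul_left (c : ℝ) (f g : ScalarField d) :
    meanMul Y (c • f) g = c * meanMul Y f g := by
  rw [meanMul, meanMul, ← integral_const_mul]
  refine integral_congr_ae ?_
  filter_upwards [ae_ofTorus (Y := Y) (AEEqFun.coeFn_smul c f)] with θ hθ
  rw [hθ, Pi.smul_apply, smul_eq_mul, mul_assoc]

theorem meanMul_add_right {f g g' : ScalarField d} (hf : f ∈ L2per Y) (hg : g ∈ L2per Y)
    (hg' : g' ∈ L2per Y) : meanMul Y f (g + g') = meanMul Y f g + meanMul Y f g' := by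
  rw [meanMul_comm, meanMul_add_left hg hg' hf, meanMul_comm g, meanMul_comm g']

theorem meanMul_smul_right (c : ℝ) (f g : ScalarField d) :
    meanMul Y f (c • g) = c * meanMul Y f g := by
  rw [meanMul_comm, meanMul_smul_left, meanMul_comm]

variable {V : Set (Pt d)}

theorem duality_eq_sum (hV : IsUnitCell Y V) {τ η : TensorField d} (hτ : τ ∈ SymL2per Y)
    (hη : η ∈ SymL2per Y) : duality V τ η = ∑ i, ∑ j, meanMul Y (τ i j) (η i j) := by
  have hp : AEPeriodic Y fun x => ∑ i, ∑ j, τ i j x * η i j x :=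
    AEPeriodic.sum _ fun i _ => AEPeriodic.sum _ fun j _ =>
      AEPeriodic.mul (hτ.2 i j).2 (hη.2 i j).2
  have hm : AEStronglyMeasurable (fun x => ∑ i, ∑ j, τ i j x * η i j x)
      (volume : Measure (Pt d)) :=
    Finset.aestronglyMeasurable_fun_sum _ fun i _ => Finset.aestronglyMeasurable_fun_sum _ fun j _ =>
      (τ i j).aestronglyMeasurable.mul (η i j).aestronglyMeasurable
  rw [duality, hp.setAverage hm hV, integral_finsetSum]
  · refine Finset.sum_congr rfl fun i _ => ?_
    rw [integral_finsetSum]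
    · rfl
    · exact fun j _ => integrable_mul_ofTorus (hτ.2 i j) (hη.2 i j)
  · exact fun i _ => integrable_finsetSum _ fun j _ =>
      integrable_mul_ofTorus (hτ.2 i j) (hη.2 i j)

theorem duality_add_left (hV : IsUnitCell Y V) {τ τ' η : TensorField d} (hτ : τ ∈ SymL2per Y)
    (hτ' : τ' ∈ SymL2per Y) (hη : η ∈ SymL2per Y) :
    duality V (τ + τ') η = duality V τ η + duality V τ' η := by
  rw [duality_eq_sum hV ((symSubmodule Y).add_mem hτ hτ') hη, duality_eq_sum hV hτ hη,
    duality_eq_sum hV hτ' hη, ← Finset.sum_add_distrib]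
  refine Finset.sum_congr rfl fun i _ => ?_
  rw [← Finset.sum_add_distrib]
  exact Finset.sum_congr rfl fun j _ => meanMul_add_left (hτ.2 i j) (hτ'.2 i j) (hη.2 i j)

theorem duality_smul_left (hV : IsUnitCell Y V) (c : ℝ) {τ η : TensorField d}
    (hτ : τ ∈ SymL2per Y) (hη : η ∈ SymL2per Y) :
    duality V (c • τ) η = c * duality V τ η := by
  rw [duality_eq_sum hV ((symSubmodule Y).smul_mem c hτ) hη, duality_eq_sum hV hτ hη,
    Finset.mul_sum]
  refine Finset.sum_congr rfl fun i _ => ?_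
  rw [Finset.mul_sum]
  exact Finset.sum_congr rfl fun j _ => meanMul_smul_left c _ _

theorem duality_comm (τ η : TensorField d) : duality V τ η = duality V η τ := by
  simp only [duality, mul_comm]

theorem duality_add_right (hV : IsUnitCell Y V) {τ η η' : TensorField d} (hτ : τ ∈ SymL2per Y)
    (hη : η ∈ SymL2per Y) (hη' : η' ∈ SymL2per Y) :
    duality V τ (η + η') = duality V τ η + duality V τ η' := by
  rw [duality_comm, duality_add_left hV hη hη' hτ, duality_comm η, duality_comm η']

theorem duality_smul_right (hV : IsUnitCell Y V) (c : ℝ) {τ η : TensorField d}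
    (hτ : τ ∈ SymL2per Y) (hη : η ∈ SymL2per Y) :
    duality V τ (c • η) = c * duality V τ η := by
  rw [duality_comm, duality_smul_left hV c hη hτ, duality_comm]

theorem duality_sub_left (hV : IsUnitCell Y V) {τ τ' η : TensorField d} (hτ : τ ∈ SymL2per Y)
    (hτ' : τ' ∈ SymL2per Y) (hη : η ∈ SymL2per Y) :
    duality V (τ - τ') η = duality V τ η - duality V τ' η := by
  have h := (symSubmodule Y).smul_mem (-1) hτ'
  rw [show τ - τ' = τ + (-1 : ℝ) • τ' by module, duality_add_left hV hτ h hη,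
    duality_smul_left hV _ hτ' hη]
  ring

/-! ### Statically admissible stress fields -/

/-- The Fourier form of the divergence-free condition. -/
def IsDivFree (Y : Module.Basis (Fin d) ℝ (Pt d)) (s : TensorField d) : Prop :=
  ∀ k i, ∑ j, (waveVec Y k j : ℂ) * coeff Y (s i j) k = 0

theorem isDivFree_iff {s : TensorField d} (hs : s ∈ SymL2per Y) :
    IsDivFree Y s ↔ ∀ i, ∀ φ : Pt d → ℝ, ContDiff ℝ ∞ φ → HasCompactSupport φ →
      ∑ j, ∫ x, s i j x * partialDeriv j φ x = 0 := by
  rw [IsDivFree, forall_comm]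
  refine forall_congr' fun i => ?_
  have h0 : (0 : ScalarField d) ∈ L2per Y := (L2perSubmodule Y).zero_mem
  have h := weak_divergence_iff (s := s i) (hs.2 i) h0
  have e1 : ∀ φ : Pt d → ℝ, ∫ x, (0 : ScalarField d) x * φ x = 0 := by
    intro φ
    refine integral_eq_zero_of_ae ?_
    filter_upwards [AEEqFun.coeFn_zero (α := Pt d) (β := ℝ) (μ := volume)] with x hx
    rw [hx]; simp
  simp only [e1, neg_zero, coeff_zero, mul_assoc _ (waveVec Y _ _ : ℂ), ← Finset.mul_sum] at h
  rw [h]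
  refine forall_congr' fun k => ?_
  have hne : (2 * Real.pi * Complex.I : ℂ) ≠ 0 := by simp [Real.pi_ne_zero]
  exact ⟨fun e => by rw [e, mul_zero], fun e => (mul_eq_zero.1 e.symm).resolve_left hne⟩

theorem isDivFree_uniformField {A : Matrix (Fin d) (Fin d) ℝ} (hA : A.IsSymm) :
    IsDivFree Y (uniformField A) := by
  rw [isDivFree_iff (uniformField_mem hA)]
  intro i φ hφ hc
  refine Finset.sum_eq_zero fun j _ => ?_
  have h : ∫ x, A i j * partialDeriv j φ x = 0 := by
    rw [integral_const_mul, integral_partialDeriv hφ hc, mul_zero]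
  rw [← h]
  refine integral_congr_ae ?_
  filter_upwards [AEEqFun.coeFn_const (Pt d) (A i j) (μ := (volume : Measure (Pt d)))] with x hx
  rw [uniformField, hx]
  rfl

theorem IsDivFree.add {s s' : TensorField d} (hs : s ∈ SymL2per Y) (hs' : s' ∈ SymL2per Y)
    (h : IsDivFree Y s) (h' : IsDivFree Y s') : IsDivFree Y (s + s') := by
  intro k i
  simp only [Pi.add_apply, coeff_add (hs.2 i _) (hs'.2 i _), mul_add, Finset.sum_add_distrib, h k i,
    h' k i, add_zero]

theorem IsDivFree.sub {s s' : TensorField d} (hs : s ∈ SymL2per Y) (hs' : s' ∈ SymL2per Y)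
    (h : IsDivFree Y s) (h' : IsDivFree Y s') : IsDivFree Y (s - s') := by
  intro k i
  simp only [Pi.sub_apply, coeff_sub (hs.2 i _) (hs'.2 i _), mul_sub, Finset.sum_sub_distrib, h k i,
    h' k i, sub_zero]

/-- Subtracting the cell average leaves a mean-free field with the same divergence, so the splitting
in `S` imposes nothing beyond zero divergence. -/
theorem mem_S_iff (hV : IsUnitCell Y V) {s : TensorField d} :
    s ∈ S Y V ↔ s ∈ SymL2per Y ∧ IsDivFree Y s := by
  constructor
  · rintro ⟨A, hA, s₀, hs₀, rfl⟩
    exact ⟨(symSubmodule Y).add_mem (uniformField_mem hA) hs₀.1,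
      (isDivFree_uniformField hA).add (uniformField_mem hA) hs₀.1
        ((isDivFree_iff hs₀.1).2 hs₀.2.1)⟩
  · rintro ⟨hs, hdiv⟩
    let A : Matrix (Fin d) (Fin d) ℝ := fun i j => ⨍ x in V, s i j x
    have hA : A.IsSymm := Matrix.IsSymm.ext fun i j => by simp only [A, hs.1 i j]
    have hU := uniformField_mem (Y := Y) hA
    have hs₀ : s - uniformField A ∈ SymL2per Y := (symSubmodule Y).sub_mem hs hU
    refine ⟨A, hA, s - uniformField A, ⟨hs₀, ?_, fun i j => ?_⟩, by abel⟩
    · exact (isDivFree_iff hs₀).1 (hdiv.sub hs hU (isDivFree_uniformField hA))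
    · have e1 := AEPeriodic.setAverage (hs.2 i j).2 (s i j).aestronglyMeasurable hV
      have e2 := AEPeriodic.setAverage (hs₀.2 i j).2
        ((s - uniformField A) i j).aestronglyMeasurable hV
      have e3 : ∀ᵐ θ ∂(volume : Measure (Torus d)), (s - uniformField A) i j (ofTorus Y θ) =
          s i j (ofTorus Y θ) - A i j := by
        filter_upwards [ae_ofTorus (Y := Y) (AEEqFun.coeFn_sub (s i j) (uniformField A i j)),
          ae_ofTorus (Y := Y)
            (AEEqFun.coeFn_const (Pt d) (A i j) (μ := (volume : Measure (Pt d))))] with θ h1 h2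
        refine h1.trans ?_
        rw [Pi.sub_apply, uniformField, h2]
        rfl
      rw [e2, integral_congr_ae e3, integral_sub
        ((memLp_ofTorus_of_mem (hs.2 i j)).integrable (by norm_num)) (integrable_const _), ← e1]
      simp [A]

/-- Statically admissible stresses are orthogonal to periodic strains. -/
theorem duality_eq_zero_of_isDivFree (hV : IsUnitCell Y V) {s h : TensorField d}
    (hs : s ∈ SymL2per Y) (hdiv : IsDivFree Y s) (hh : h ∈ E₀ Y) : duality V s h = 0 := by
  obtain ⟨hsym, w, G, hw, hG⟩ := hh
  have hGm : ∀ i j, G i j ∈ L2per Y := fun i j => ((hw i).2 j).1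
  have hrow : ∀ i, ∑ j, meanMul Y (s i j) (G i j) = 0 := by
    intro i
    have h1 := hasSum_sum (s := Finset.univ) fun j _ => hasSum_conj_coeff_mul (hs.2 i j) (hGm i j)
    have h2 : ∀ k, ∑ j, conj (coeff Y (s i j) k) * coeff Y (G i j) k = 0 := by
      intro k
      -- The gradient coefficients are 2πi κ_j ŵ_i, so the sum over `j` factors through the
      -- conjugate of the divergence condition.
      have h3 := congrArg conj (hdiv k i)
      simp only [map_sum, map_mul, Complex.conj_ofReal, map_zero] at h3
      calc ∑ j, conj (coeff Y (s i j) k) * coeff Y (G i j) k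
          = (2 * Real.pi * Complex.I * coeff Y (w i) k) *
              ∑ j, (waveVec Y k j : ℂ) * conj (coeff Y (s i j) k) := by
            rw [Finset.mul_sum]
            refine Finset.sum_congr rfl fun j _ => ?_
            rw [(isWeakPartial_iff (hw i).1 (hGm i j)).1 ((hw i).2 j).2]
            ring
        _ = 0 := by rw [h3, mul_zero]
    simp only [h2] at h1
    have h4 := h1.unique hasSum_zero
    exact_mod_cast h4
  -- The symmetry of `s` turns the transposed gradient into the case just treated.
  have hrow' : ∑ i, ∑ j, meanMul Y (s i j) (G j i) = 0 := by
    rw [Finset.sum_comm]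
    refine Finset.sum_eq_zero fun j _ => ?_
    rw [← hrow j]
    exact Finset.sum_congr rfl fun i _ => by rw [hs.1 i j]
  rw [duality_eq_sum hV hs hsym]
  simp only [hG, meanMul_smul_right, meanMul_add_right (hs.2 _ _) (hGm _ _) (hGm _ _),
    ← Finset.mul_sum, Finset.sum_add_distrib, hrow, hrow']
  simp

/-! ### The acoustic tensor -/

/-- The acoustic tensor of `C` in the direction `κ`. -/
def acoustic (C : Tensor4 d) (κ : Fin d → ℝ) : Matrix (Fin d) (Fin d) ℝ :=
  fun i p => ∑ j, ∑ q, C i j p q * κ j * κ q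

/-- By the minor symmetries `C` only sees the symmetric part of a ⊗ κ, which brings the quadratic
form within reach of `hC.pos`. -/
theorem acoustic_quadratic_eq {C : Tensor4 d} (hC : IsElasticityTensor C) (κ a : Fin d → ℝ) :
    ∑ i, ∑ p, acoustic C κ i p * a i * a p =
      ∑ i, ∑ j, ∑ p, ∑ q, C i j p q * (1 / 2 * (a p * κ q + a q * κ p)) *
        (1 / 2 * (a i * κ j + a j * κ i)) := by
  let T : ℝ := ∑ i, ∑ j, ∑ p, ∑ q, C i j p q * (a p * κ q) * (a i * κ j)
  have h1 : ∑ i, ∑ p, acoustic C κ i p * a i * a p = T := by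
    refine Finset.sum_congr rfl fun i _ => ?_
    rw [Finset.sum_comm]
    refine Finset.sum_congr rfl fun p _ => ?_
    simp only [acoustic, Finset.sum_mul]
    exact Finset.sum_congr rfl fun j _ => Finset.sum_congr rfl fun q _ => by ring
  have hr : ∀ i j, ∑ p, ∑ q, C i j p q * (a q * κ p) = ∑ p, ∑ q, C i j p q * (a p * κ q) := by
    intro i j
    rw [Finset.sum_comm]
    exact Finset.sum_congr rfl fun p _ => Finset.sum_congr rfl fun q _ => by
      rw [hC.minor_right i j q p]
  have hin : ∀ i j, ∑ p, ∑ q, C i j p q * (1 / 2 * (a p * κ q + a q * κ p)) =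
      ∑ p, ∑ q, C i j p q * (a p * κ q) := by
    intro i j
    calc _ = 1 / 2 * (∑ p, ∑ q, C i j p q * (a p * κ q) + ∑ p, ∑ q, C i j p q * (a q * κ p)) := by
          simp only [← Finset.sum_add_distrib, Finset.mul_sum]
          exact Finset.sum_congr rfl fun p _ => Finset.sum_congr rfl fun q _ => by ring
      _ = _ := by rw [hr]; ring
  let u : Fin d → Fin d → ℝ := fun i j => ∑ p, ∑ q, C i j p q * (a p * κ q)
  have hu : ∀ i j, u i j = u j i := fun i j =>
    Finset.sum_congr rfl fun p _ => Finset.sum_congr rfl fun q _ => by rw [hC.minor_left]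
  have hT : T = ∑ i, ∑ j, u i j * (a i * κ j) := by
    simp only [T, u, Finset.sum_mul]
  have hT' : ∑ i, ∑ j, u i j * (a j * κ i) = T := by
    rw [hT, Finset.sum_comm]
    exact Finset.sum_congr rfl fun i _ => Finset.sum_congr rfl fun j _ => by rw [hu]
  rw [h1]
  symm
  calc _ = ∑ i, ∑ j, u i j * (1 / 2 * (a i * κ j + a j * κ i)) := by
        simp only [← Finset.sum_mul, hin, u]
    _ = 1 / 2 * (∑ i, ∑ j, u i j * (a i * κ j) + ∑ i, ∑ j, u i j * (a j * κ i)) := by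
        simp only [← Finset.sum_add_distrib, Finset.mul_sum]
        exact Finset.sum_congr rfl fun p _ => Finset.sum_congr rfl fun q _ => by ring
    _ = T := by rw [hT', ← hT]; ring

/-- The symmetric part of a ⊗ κ is nonzero: if it vanished, a diagonal entry with κ_j ≠ 0 would give
a_j = 0, and then column `j` would give a = 0. -/
theorem acoustic_quadratic_pos {C : Tensor4 d} (hC : IsElasticityTensor C) {κ a : Fin d → ℝ}
    (hκ : κ ≠ 0) (ha : a ≠ 0) : 0 < ∑ i, ∑ p, acoustic C κ i p * a i * a p := by
  rw [acoustic_quadratic_eq hC]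
  refine hC.pos (fun i j => 1 / 2 * (a i * κ j + a j * κ i)) ?_ ?_
  · exact Matrix.IsSymm.ext fun i j => by ring
  · intro h0
    have h : ∀ i j, a i * κ j + a j * κ i = 0 := by
      intro i j
      have := congrFun (congrFun h0 i) j
      simp only [Matrix.zero_apply] at this
      linarith
    obtain ⟨j, hj⟩ := Function.ne_iff.1 hκ
    have hj' : κ j ≠ 0 := hj
    have haj : a j = 0 := by
      have := h j j
      have h2 : a j * κ j = 0 := by linarith
      exact (mul_eq_zero.1 h2).resolve_right hj'
    refine ha (funext fun i => ?_)
    have := h i j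
    rw [haj, zero_mul, add_zero] at this
    exact (mul_eq_zero.1 this).resolve_right hj'

/-- The form is positive on a compact product of unit spheres and homogeneous of degree 2 in each
variable. -/
theorem exists_acoustic_coercive {C : Tensor4 d} (hC : IsElasticityTensor C) :
    ∃ c > 0, ∀ κ a : Fin d → ℝ, c * (∑ j, κ j ^ 2) * (∑ i, a i ^ 2) ≤
      ∑ i, ∑ p, acoustic C κ i p * a i * a p := by
  let Q : Pt d × Pt d → ℝ := fun z => ∑ i, ∑ p, acoustic C z.1 i p * z.2 i * z.2 p
  have hQ : Continuous Q := by
    unfold Q acoustic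
    fun_prop
  have hK : IsCompact (Metric.sphere (0 : Pt d) 1 ×ˢ Metric.sphere (0 : Pt d) 1) :=
    (isCompact_sphere _ _).prod (isCompact_sphere _ _)
  have hne : ∀ x : Pt d, ‖x‖ = 1 → (x : Fin d → ℝ) ≠ 0 := by
    intro x hx h0
    have : x = 0 := by ext i; exact congrFun h0 i
    simp [this] at hx
  obtain ⟨c, hc, hcb⟩ : ∃ c > 0, ∀ z ∈ Metric.sphere (0 : Pt d) 1 ×ˢ Metric.sphere (0 : Pt d) 1,
      c ≤ Q z := by
    rcases (Metric.sphere (0 : Pt d) 1 ×ˢ Metric.sphere (0 : Pt d) 1).eq_empty_or_nonempty with h | h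
    -- The unit sphere is empty when `d = 0`, and any constant serves.
    · exact ⟨1, one_pos, fun z hz => by rw [h] at hz; exact hz.elim⟩
    · obtain ⟨z, hz, hmin⟩ := hK.exists_isMinOn h hQ.continuousOn
      refine ⟨Q z, acoustic_quadratic_pos hC (hne _ ?_) (hne _ ?_), fun w hw => hmin hw⟩
      · simpa using hz.1
      · simpa using hz.2
  refine ⟨c, hc, fun κ a => ?_⟩
  by_cases hκ : κ = 0
  · subst hκ; simp [acoustic]
  by_cases ha : a = 0
  · subst ha; simp
  let x : Pt d := WithLp.toLp 2 κ
  let y : Pt d := WithLp.toLp 2 a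
  have hx : ‖x‖ ≠ 0 := by
    rw [norm_ne_zero_iff]
    intro h; exact hκ (funext fun i => congrArg (fun v : Pt d => v i) h)
  have hy : ‖y‖ ≠ 0 := by
    rw [norm_ne_zero_iff]
    intro h; exact ha (funext fun i => congrArg (fun v : Pt d => v i) h)
  have h1 := hcb (‖x‖⁻¹ • x, ‖y‖⁻¹ • y) ⟨by simp [norm_smul, hx], by simp [norm_smul, hy]⟩
  have h2 : Q (‖x‖⁻¹ • x, ‖y‖⁻¹ • y) =
      (‖x‖⁻¹ ^ 2 * ‖y‖⁻¹ ^ 2) * ∑ i, ∑ p, acoustic C κ i p * a i * a p := by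
    simp only [Q, acoustic, PiLp.smul_apply, smul_eq_mul, Finset.mul_sum, Finset.sum_mul, x, y]
    refine Finset.sum_congr rfl fun i _ => Finset.sum_congr rfl fun p _ =>
      Finset.sum_congr rfl fun j _ => Finset.sum_congr rfl fun q _ => by ring
  have hxs : ‖x‖ ^ 2 = ∑ j, κ j ^ 2 := by simp [EuclideanSpace.norm_sq_eq, x]
  have hys : ‖y‖ ^ 2 = ∑ j, a j ^ 2 := by simp [EuclideanSpace.norm_sq_eq, y]
  rw [h2] at h1
  rw [← hxs, ← hys]
  have hp : 0 < ‖x‖ ^ 2 * ‖y‖ ^ 2 := by positivity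
  calc c * ‖x‖ ^ 2 * ‖y‖ ^ 2 = (‖x‖ ^ 2 * ‖y‖ ^ 2) * c := by ring
    _ ≤ (‖x‖ ^ 2 * ‖y‖ ^ 2) * ((‖x‖⁻¹ ^ 2 * ‖y‖⁻¹ ^ 2) *
          ∑ i, ∑ p, acoustic C κ i p * a i * a p) := by gcongr
    _ = _ := by field_simp

/-- A column x of the inverse solves Ax = e_p, so coercivity reads c|κ|²|x|² ≤ x_p, which forces
c|κ|²|x_i| ≤ 1. For κ = 0 the bound is trivial. -/
theorem exists_acoustic_inv_bound {C : Tensor4 d} (hC : IsElasticityTensor C) :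
    ∃ M, 0 ≤ M ∧ ∀ κ : Fin d → ℝ,
      (∀ i p, |(acoustic C κ)⁻¹ i p| * ∑ j, κ j ^ 2 ≤ M) ∧
      (κ ≠ 0 → acoustic C κ * (acoustic C κ)⁻¹ = 1) := by
  obtain ⟨c, hc, h⟩ := exists_acoustic_coercive hC
  refine ⟨c⁻¹, by positivity, fun κ => ?_⟩
  by_cases hκ : κ = 0
  · subst hκ
    simp [hc.le]
  have hn : 0 < ∑ j, κ j ^ 2 := by
    obtain ⟨j, hj⟩ := Function.ne_iff.1 hκ
    have hj' : κ j ≠ 0 := hj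
    exact lt_of_lt_of_le (by positivity : 0 < κ j ^ 2)
      (Finset.single_le_sum (fun i _ => sq_nonneg (κ i)) (Finset.mem_univ j))
  set n := ∑ j, κ j ^ 2
  set A := acoustic C κ
  have hq : ∀ a : Fin d → ℝ, ∑ i, ∑ p, A i p * a i * a p = ∑ i, a i * (A.mulVec a) i := by
    intro a
    refine Finset.sum_congr rfl fun i _ => ?_
    rw [Matrix.mulVec, dotProduct, Finset.mul_sum]
    exact Finset.sum_congr rfl fun p _ => by ring
  have hdet : IsUnit A.det := by
    rw [isUnit_iff_ne_zero]
    intro h0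
    obtain ⟨v, hv, hv0⟩ := Matrix.exists_mulVec_eq_zero_iff.2 h0
    have := acoustic_quadratic_pos hC hκ hv
    rw [hq, hv0] at this
    simp at this
  have hinv : A * A⁻¹ = 1 := Matrix.mul_nonsing_inv A hdet
  refine ⟨fun i p => ?_, fun _ => hinv⟩
  let x : Fin d → ℝ := fun i => A⁻¹ i p
  have hx : A.mulVec x = fun i => (1 : Matrix (Fin d) (Fin d) ℝ) i p := by
    funext i
    rw [← hinv]
    rfl
  have h1 := h κ x
  rw [hq, hx] at h1
  have h2 : ∑ i, x i * (1 : Matrix (Fin d) (Fin d) ℝ) i p = x p := by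
    simp [Matrix.one_apply]
  rw [h2] at h1
  have hle : ∀ i, x i ^ 2 ≤ ∑ i, x i ^ 2 := fun i =>
    Finset.single_le_sum (fun i _ => sq_nonneg (x i)) (Finset.mem_univ i)
  have hcn : 0 < c * n := by positivity
  have h3 : ∀ i, c * n * x i ^ 2 ≤ x p := fun i =>
    (mul_le_mul_of_nonneg_left (hle i) hcn.le).trans h1
  have h4 : c * n * x p ≤ 1 := by
    have h5 := h3 p
    by_contra hlt
    push Not at hlt
    have hxp : 0 < x p := by
      by_contra h0
      push Not at h0
      nlinarith
    nlinarith
  have h6 : (c * n * |x i|) ^ 2 ≤ 1 := by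
    rw [mul_pow, sq_abs]
    have := mul_le_mul_of_nonneg_left (h3 i) hcn.le
    nlinarith
  have h7 : c * n * |x i| ≤ 1 := by
    have : 0 ≤ c * n * |x i| := by positivity
    nlinarith
  rw [inv_eq_one_div c, le_div_iff₀ hc]
  change |x i| * n * c ≤ 1
  linarith

/-! ### Solution of the Eshelby problem -/

theorem summable_sq_of_le_sum {ι κ : Type*} [Fintype ι] {a : κ → ℂ} {b : ι → κ → ℂ}
    (hb : ∀ i, Summable fun k => ‖b i k‖ ^ 2) {M : ℝ} (h : ∀ k, ‖a k‖ ≤ M * ∑ i, ‖b i k‖) :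
    Summable fun k => ‖a k‖ ^ 2 := by
  have h1 : Summable fun k => M ^ 2 * (Fintype.card ι * ∑ i, ‖b i k‖ ^ 2) :=
    ((summable_sum fun i _ => hb i).mul_left _).mul_left _
  refine Summable.of_nonneg_of_le (fun k => sq_nonneg _) (fun k => ?_) h1
  calc ‖a k‖ ^ 2 ≤ (M * ∑ i, ‖b i k‖) ^ 2 := by gcongr; exact h k
    _ = M ^ 2 * (∑ i, ‖b i k‖) ^ 2 := by ring
    _ ≤ _ := by gcongr; exact sq_sum_le_card_mul_sum_sq

theorem waveVec_neg (k : Fin d → ℤ) (j : Fin d) : waveVec Y (-k) j = -waveVec Y k j := by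
  simp [waveVec]

/-- The wave vector is expressed in the dual basis, so pairing it with a period recovers an integer
coordinate. This keeps nonzero wave vectors away from zero. -/
theorem sum_waveVec_mul (k : Fin d → ℤ) (l : Fin d) : ∑ j, waveVec Y k j * Y l j = k l := by
  have h1 : Y l = ∑ j, (Y l j) • EuclideanSpace.single j (1 : ℝ) := by
    ext i
    simp [Finset.sum_apply, Pi.single_apply]
  have h2 : ∀ i, Y.repr (Y l) i = ∑ j, Y l j * Y.repr (EuclideanSpace.single j 1) i := by
    intro i
    conv_lhs => rw [h1]
    simp [map_sum, Finsupp.finsetSum_apply]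
  calc ∑ j, waveVec Y k j * Y l j = ∑ i, k i * Y.repr (Y l) i := by
        simp only [waveVec, h2, Finset.sum_mul, Finset.mul_sum]
        rw [Finset.sum_comm]
        exact Finset.sum_congr rfl fun i _ => Finset.sum_congr rfl fun j _ => by ring
    _ = k l := by
        simp [Finsupp.single_apply]

theorem waveVec_ne_zero {k : Fin d → ℤ} (hk : k ≠ 0) : waveVec Y k ≠ 0 := by
  intro h
  refine hk (funext fun l => ?_)
  have := sum_waveVec_mul (Y := Y) k l
  rw [h] at this
  simpa using this.symm

theorem waveVec_zero : waveVec Y (0 : Fin d → ℤ) = 0 := by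
  funext j
  simp [waveVec]

theorem act_mem {C : Tensor4 d} (hC : IsElasticityTensor C) {η : TensorField d}
    (hη : η ∈ SymL2per Y) : C.act η ∈ SymL2per Y := by
  refine ⟨fun i j => ?_, fun i j => ?_⟩
  · exact Finset.sum_congr rfl fun k _ => Finset.sum_congr rfl fun l _ => by rw [hC.minor_left]
  · exact (L2perSubmodule Y).sum_mem fun k _ => (L2perSubmodule Y).sum_mem fun l _ =>
      (L2perSubmodule Y).smul_mem _ (hη.2 k l)

theorem coeff_act {C : Tensor4 d} {η : TensorField d} (hη : η ∈ SymL2per Y) (i j : Fin d)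
    (n : Fin d → ℤ) : coeff Y (C.act η i j) n = ∑ k, ∑ l, (C i j k l : ℂ) * coeff Y (η k l) n := by
  rw [Tensor4.act, coeff_sum _ fun k _ => (L2perSubmodule Y).sum_mem fun l _ =>
      (L2perSubmodule Y).smul_mem _ (hη.2 k l)]
  refine Finset.sum_congr rfl fun k _ => ?_
  rw [coeff_sum _ fun l _ => (L2perSubmodule Y).smul_mem _ (hη.2 k l)]
  simp only [coeff_smul]

/-- For each frequency with wave vector κ, the equation div(C e - τ) = 0 becomes acoustic(κ) û = τ̂
κ, with û equal to 2πi times the displacement coefficient. It remains to see that these coefficients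
define real square integrable fields. -/
theorem exists_isEshelbySolution {V : Set (Pt d)} (hV : IsUnitCell Y V) {C : Tensor4 d}
    (hC : IsElasticityTensor C) {τ : TensorField d} (hτ : τ ∈ SymL2per Y) :
    ∃ e, IsEshelbySolution Y V C τ e := by
  obtain ⟨M, hM0, hM⟩ := exists_acoustic_inv_bound hC
  -- At `k = 0` the acoustic tensor vanishes and `B` carries no information; this is harmless
  -- because `b 0 = 0`, so the zero mode of the solution is zero.
  let B : (Fin d → ℤ) → Matrix (Fin d) (Fin d) ℝ := fun k => (acoustic C (waveVec Y k))⁻¹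
  let b : (Fin d → ℤ) → Fin d → ℂ := fun k p => ∑ j, (waveVec Y k j : ℂ) * coeff Y (τ p j) k
  let u : Fin d → (Fin d → ℤ) → ℂ := fun i k => ∑ p, (B k i p : ℂ) * b k p
  have hBneg : ∀ k, B (-k) = B k := by
    intro k
    simp only [B]
    congr 1
    funext i p
    simp only [acoustic, waveVec_neg]
    exact Finset.sum_congr rfl fun j _ => Finset.sum_congr rfl fun q _ => by ring
  have hbneg : ∀ k p, b (-k) p = -conj (b k p) := by
    intro k p
    simp only [b, waveVec_neg, coeff_neg_index, map_sum, map_mul, Complex.conj_ofReal,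
      Complex.ofReal_neg, neg_mul, Finset.sum_neg_distrib]
  -- The data `b` are odd in the wave vector and `B` is even. Multiplying by (2πi)⁻¹ or by a
  -- component of κ restores the Hermitian symmetry required by `exists_coeff_eq`.
  have huneg : ∀ i k, u i (-k) = -conj (u i k) := by
    intro i k
    simp only [u, hBneg, hbneg, map_sum, map_mul, Complex.conj_ofReal, mul_neg,
      Finset.sum_neg_distrib]
  -- The |κ|⁻² decay of `B` absorbs exactly two factors of κ, one from the divergence of τ and one
  -- from the gradient.
  have hGbound : ∀ i q k, ‖(waveVec Y k q : ℂ) * u i k‖ ≤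
      M * ∑ z : Fin d × Fin d, ‖coeff Y (τ z.1 z.2) k‖ := by
    intro i q k
    have hkk : ∀ j, |waveVec Y k q| * |waveVec Y k j| ≤ ∑ j, waveVec Y k j ^ 2 := by
      intro j
      have h1 : waveVec Y k q ^ 2 ≤ ∑ j, waveVec Y k j ^ 2 :=
        Finset.single_le_sum (fun i _ => sq_nonneg (waveVec Y k i)) (Finset.mem_univ q)
      have h2 : waveVec Y k j ^ 2 ≤ ∑ j, waveVec Y k j ^ 2 :=
        Finset.single_le_sum (fun i _ => sq_nonneg (waveVec Y k i)) (Finset.mem_univ j)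
      nlinarith [sq_abs (waveVec Y k q), sq_abs (waveVec Y k j),
        sq_nonneg (|waveVec Y k q| - |waveVec Y k j|)]
    have e : (waveVec Y k q : ℂ) * u i k = ∑ z : Fin d × Fin d,
        ((B k i z.1 * (waveVec Y k q * waveVec Y k z.2) : ℝ) : ℂ) * coeff Y (τ z.1 z.2) k := by
      simp only [u, b, Fintype.sum_prod_type, Finset.mul_sum]
      refine Finset.sum_congr rfl fun p _ => Finset.sum_congr rfl fun j _ => ?_
      push_cast
      ring
    rw [e, Finset.mul_sum]
    refine (norm_sum_le _ _).trans (Finset.sum_le_sum fun z _ => ?_)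
    rw [norm_mul, Complex.norm_real, Real.norm_eq_abs, abs_mul, abs_mul]
    gcongr
    exact (mul_le_mul_of_nonneg_left (hkk z.2) (abs_nonneg _)).trans ((hM (waveVec Y k)).1 i z.1)
  have hGsum : ∀ i q, Summable fun k => ‖(waveVec Y k q : ℂ) * u i k‖ ^ 2 := fun i q =>
    summable_sq_of_le_sum (b := fun (z : Fin d × Fin d) k => coeff Y (τ z.1 z.2) k)
      (fun z => summable_norm_coeff_sq (hτ.2 z.1 z.2)) (hGbound i q)
  have husum : ∀ i, Summable fun k => ‖u i k‖ ^ 2 := by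
    intro i
    -- A Poincaré inequality in frequency space: for k ≠ 0 some |k_l| is at least 1, and k_l is the
    -- pairing of κ with `Y l`.
    refine summable_sq_of_le_sum (hGsum i) (M := ∑ l, ∑ j, |Y l j|) fun k => ?_
    by_cases hk : k = 0
    · have : u i k = 0 := by simp [u, b, hk, waveVec_zero]
      rw [this, norm_zero]
      positivity
    · obtain ⟨l, hl⟩ := Function.ne_iff.1 hk
      have hl1 : (1 : ℝ) ≤ |(k l : ℝ)| := by
        have : (1 : ℤ) ≤ |k l| := Int.one_le_abs hl
        exact_mod_cast this
      have e : (k l : ℂ) * u i k = ∑ j, (Y l j : ℂ) * ((waveVec Y k j : ℂ) * u i k) := by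
        have h := congrArg (fun t : ℝ => (t : ℂ)) (sum_waveVec_mul (Y := Y) k l)
        simp only [Complex.ofReal_sum, Complex.ofReal_mul, Complex.ofReal_intCast] at h
        rw [← h, Finset.sum_mul]
        exact Finset.sum_congr rfl fun j _ => by ring
      calc ‖u i k‖ ≤ |(k l : ℝ)| * ‖u i k‖ := le_mul_of_one_le_left (norm_nonneg _) hl1
        _ = ‖(k l : ℂ) * u i k‖ := by
            rw [norm_mul, ← Complex.ofReal_intCast, Complex.norm_real, Real.norm_eq_abs]
        _ ≤ ∑ j, |Y l j| * ‖(waveVec Y k j : ℂ) * u i k‖ := by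
            rw [e]
            refine (norm_sum_le _ _).trans (Finset.sum_le_sum fun j _ => ?_)
            rw [norm_mul, Complex.norm_real, Real.norm_eq_abs]
        _ ≤ ∑ j, (∑ l, ∑ j, |Y l j|) * ‖(waveVec Y k j : ℂ) * u i k‖ := by
            refine Finset.sum_le_sum fun j _ => mul_le_mul_of_nonneg_right ?_ (norm_nonneg _)
            refine (Finset.single_le_sum (f := fun j => |Y l j|) (fun _ _ => abs_nonneg _)
              (Finset.mem_univ j)).trans ?_
            exact Finset.single_le_sum (f := fun l => ∑ j, |Y l j|)
              (fun _ _ => Finset.sum_nonneg fun _ _ => abs_nonneg _) (Finset.mem_univ l)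
        _ = _ := (Finset.mul_sum _ _ _).symm
  have hne : (2 * Real.pi * Complex.I : ℂ) ≠ 0 := by simp [Real.pi_ne_zero]
  have hW : ∀ i, ∃ f ∈ L2per Y, ∀ k, coeff Y f k = (2 * Real.pi * Complex.I)⁻¹ * u i k := by
    intro i
    refine exists_coeff_eq ?_ fun k => ?_
    · simp only [norm_mul, mul_pow]
      exact (husum i).mul_left _
    · rw [huneg, map_mul, map_inv₀, map_mul, map_mul, Complex.conj_I, Complex.conj_ofReal,
        Complex.conj_ofNat, mul_neg, mul_neg, inv_neg, neg_mul]
  have hG : ∀ i q, ∃ f ∈ L2per Y, ∀ k, coeff Y f k = (waveVec Y k q : ℂ) * u i k := by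
    intro i q
    refine exists_coeff_eq (hGsum i q) fun k => ?_
    rw [huneg, waveVec_neg, map_mul, Complex.conj_ofReal, Complex.ofReal_neg, neg_mul_neg]
  choose w hw hwc using hW
  choose G hGm hGc using hG
  let e : TensorField d := fun i j => (1 / 2 : ℝ) • (G i j + G j i)
  have hes : e ∈ SymL2per Y :=
    ⟨fun i j => by simp only [e, add_comm], fun i j => (L2perSubmodule Y).smul_mem _
      ((L2perSubmodule Y).add_mem (hGm i j) (hGm j i))⟩
  have heE : e ∈ E₀ Y := by
    refine ⟨hes, w, G, fun i => ⟨hw i, fun j => ⟨hGm i j, ?_⟩⟩, fun i j => rfl⟩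
    refine (isWeakPartial_iff (hw i) (hGm i j)).2 fun k => ?_
    rw [hwc, hGc]
    field_simp
  have hec : ∀ i j k, coeff Y (e i j) k =
      1 / 2 * ((waveVec Y k j : ℂ) * u i k + (waveVec Y k i : ℂ) * u j k) := by
    intro i j k
    simp only [e, coeff_smul, coeff_add (hGm i j) (hGm j i), hGc]
    push_cast
    ring
  have hact := act_mem hC hes
  refine ⟨e, heE, (mem_S_iff hV).2 ⟨(symSubmodule Y).sub_mem hact hτ, fun k i => ?_⟩⟩
  by_cases hk : k = 0
  · simp [hk, waveVec_zero]
  have hstress : ∀ j, coeff Y (C.act e i j) k =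
      ∑ p, ∑ q, (C i j p q : ℂ) * ((waveVec Y k q : ℂ) * u p k) := by
    intro j
    have hr : ∑ p, ∑ q, (C i j p q : ℂ) * ((waveVec Y k p : ℂ) * u q k) =
        ∑ p, ∑ q, (C i j p q : ℂ) * ((waveVec Y k q : ℂ) * u p k) := by
      rw [Finset.sum_comm]
      exact Finset.sum_congr rfl fun p _ => Finset.sum_congr rfl fun q _ => by
        rw [hC.minor_right i j q p]
    calc coeff Y (C.act e i j) k
        = 1 / 2 * (∑ p, ∑ q, (C i j p q : ℂ) * ((waveVec Y k q : ℂ) * u p k) +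
            ∑ p, ∑ q, (C i j p q : ℂ) * ((waveVec Y k p : ℂ) * u q k)) := by
          rw [coeff_act hes]
          simp only [hec, ← Finset.sum_add_distrib, Finset.mul_sum]
          exact Finset.sum_congr rfl fun p _ => Finset.sum_congr rfl fun q _ => by ring
      _ = _ := by rw [hr]; ring
  have hinv := (hM (waveVec Y k)).2 (waveVec_ne_zero hk)
  have hAB : ∀ r, ∑ p, (acoustic C (waveVec Y k) i p : ℂ) * (B k p r : ℂ) =
      if i = r then 1 else 0 := by
    intro r
    have h := congrArg (fun m : Matrix (Fin d) (Fin d) ℝ => ((m i r : ℝ) : ℂ)) hinv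
    simp only [Matrix.mul_apply, Complex.ofReal_sum, Complex.ofReal_mul, Matrix.one_apply] at h
    rw [h]
    split_ifs <;> simp
  -- The divergence of the stress is the acoustic tensor applied to `u`, which was chosen to match
  -- the divergence of τ.
  have hsum : ∑ j, (waveVec Y k j : ℂ) * coeff Y (C.act e i j) k =
      ∑ p, (acoustic C (waveVec Y k) i p : ℂ) * u p k := by
    simp only [hstress, acoustic, Complex.ofReal_sum, Finset.mul_sum, Finset.sum_mul]
    rw [Finset.sum_comm]
    refine Finset.sum_congr rfl fun p _ => Finset.sum_congr rfl fun j _ =>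
      Finset.sum_congr rfl fun q _ => ?_
    push_cast
    ring
  have hsol : ∑ p, (acoustic C (waveVec Y k) i p : ℂ) * u p k = b k i := by
    simp only [u, Finset.mul_sum]
    rw [Finset.sum_comm]
    simp only [← mul_assoc, ← Finset.sum_mul, hAB]
    simp
  simp only [Pi.sub_apply, coeff_sub (hact.2 i _) (hτ.2 i _), mul_sub, Finset.sum_sub_distrib]
  rw [hsum, hsol, sub_self]

/-! ### Heterogeneous elasticity fields -/

theorem coeFn_sum {ι : Type*} (s : Finset ι) (f : ι → ScalarField d) :
    ⇑(∑ i ∈ s, f i) =ᵐ[volume] fun x => ∑ i ∈ s, f i x := by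
  classical
  induction s using Finset.induction_on with
  | empty =>
    filter_upwards [AEEqFun.coeFn_zero (α := Pt d) (β := ℝ) (μ := volume)] with x hx
    simp [hx]
  | insert a s ha ih =>
    rw [Finset.sum_insert ha]
    filter_upwards [ih, AEEqFun.coeFn_add (f a) (∑ i ∈ s, f i)] with x h1 h2
    rw [h2, Pi.add_apply, h1, Finset.sum_insert ha]

theorem mul_add_scalarField (f g h : ScalarField d) : f * (g + h) = f * g + f * h := by
  refine AEEqFun.ext ?_
  filter_upwards [AEEqFun.coeFn_mul f (g + h), AEEqFun.coeFn_add g h, AEEqFun.coeFn_mul f g,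
    AEEqFun.coeFn_mul f h, AEEqFun.coeFn_add (f * g) (f * h)] with x h1 h2 h3 h4 h5
  rw [h1, h5, Pi.mul_apply, h2, Pi.add_apply, Pi.add_apply, h3, h4, Pi.mul_apply, Pi.mul_apply,
    mul_add]

theorem mul_smul_scalarField (c : ℝ) (f g : ScalarField d) : f * (c • g) = c • (f * g) := by
  refine AEEqFun.ext ?_
  filter_upwards [AEEqFun.coeFn_mul f (c • g), AEEqFun.coeFn_smul c g, AEEqFun.coeFn_mul f g,
    AEEqFun.coeFn_smul c (f * g)] with x h1 h2 h3 h4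
  rw [h1, h4, Pi.mul_apply, h2, Pi.smul_apply, Pi.smul_apply, h3, Pi.mul_apply, mul_smul_comm]

namespace Tensor4Field

theorem act_add (L : Tensor4Field d) (η η' : TensorField d) :
    L.act (η + η') = L.act η + L.act η' := by
  funext i j
  simp only [Tensor4Field.act, Pi.add_apply, mul_add_scalarField, Finset.sum_add_distrib]

theorem act_smul (L : Tensor4Field d) (c : ℝ) (η : TensorField d) :
    L.act (c • η) = c • L.act η := by
  funext i j
  simp only [Tensor4Field.act, Pi.smul_apply, mul_smul_scalarField, Finset.smul_sum]

theorem coeFn_act (L : Tensor4Field d) (η : TensorField d) (i j : Fin d) :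
    ⇑(L.act η i j) =ᵐ[volume] fun x => ∑ k, ∑ l, L i j k l x * η k l x := by
  have h1 := coeFn_sum Finset.univ fun k => ∑ l, L i j k l * η k l
  have h2 : ∀ᵐ x ∂(volume : Measure (Pt d)), ∀ k,
      (∑ l, L i j k l * η k l : ScalarField d) x = ∑ l, (L i j k l * η k l) x :=
    ae_all_iff.2 fun k => coeFn_sum _ _
  have h3 : ∀ᵐ x ∂(volume : Measure (Pt d)), ∀ k l,
      (L i j k l * η k l) x = L i j k l x * η k l x :=
    ae_all_iff.2 fun k => ae_all_iff.2 fun l => AEEqFun.coeFn_mul _ _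
  filter_upwards [h1, h2, h3] with x e1 e2 e3
  refine e1.trans (Finset.sum_congr rfl fun k _ => ?_)
  rw [e2]
  exact Finset.sum_congr rfl fun l _ => e3 k l

end Tensor4Field

/-- A uniform elasticity tensor as a field. -/
def constField (C : Tensor4 d) : Tensor4Field d := fun i j k l => AEEqFun.const (Pt d) (C i j k l)

theorem coeFn_constField (C : Tensor4 d) :
    ∀ᵐ x ∂(volume : Measure (Pt d)), ∀ i j k l, constField C i j k l x = C i j k l :=
  ae_all_iff.2 fun i => ae_all_iff.2 fun j => ae_all_iff.2 fun k => ae_all_iff.2 fun l =>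
    AEEqFun.coeFn_const (Pt d) (C i j k l)

/-- Treating `C` as a heterogeneous field lets the symmetry and positivity of the energetic product
be inherited from the results for fields. -/
theorem constField_act (C : Tensor4 d) (η : TensorField d) :
    (constField C).act η = C.act η := by
  funext i j
  refine Finset.sum_congr rfl fun k _ => Finset.sum_congr rfl fun l _ => AEEqFun.ext ?_
  filter_upwards [coeFn_constField C, AEEqFun.coeFn_mul (constField C i j k l) (η k l),
    AEEqFun.coeFn_smul (C i j k l) (η k l)] with x h1 h2 h3
  rw [h2, h3, Pi.mul_apply, h1, Pi.smul_apply, smul_eq_mul]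

theorem isElasticityField_constField {C : Tensor4 d} (hC : IsElasticityTensor C) :
    IsElasticityField Y (constField C) where
  elastic := by
    filter_upwards [coeFn_constField C] with x hx
    simpa only [hx] using hC
  periodic i j k l := (const_mem_L2per (C i j k l)).2
  bounded := by
    refine ⟨∑ i, ∑ j, ∑ k, ∑ l, |C i j k l|, fun i j k l => ?_⟩
    filter_upwards [coeFn_constField C] with x hx
    rw [hx]
    calc |C i j k l| ≤ ∑ l, |C i j k l| :=
          Finset.single_le_sum (f := fun l => |C i j k l|) (fun _ _ => by positivity)
            (Finset.mem_univ l)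
      _ ≤ ∑ k, ∑ l, |C i j k l| :=
          Finset.single_le_sum (f := fun k => ∑ l, |C i j k l|) (fun _ _ => by positivity)
            (Finset.mem_univ k)
      _ ≤ ∑ j, ∑ k, ∑ l, |C i j k l| :=
          Finset.single_le_sum (f := fun j => ∑ k, ∑ l, |C i j k l|) (fun _ _ => by positivity)
            (Finset.mem_univ j)
      _ ≤ _ :=
          Finset.single_le_sum (f := fun i => ∑ j, ∑ k, ∑ l, |C i j k l|)
            (fun _ _ => by positivity) (Finset.mem_univ i)

namespace IsElasticityField

variable {L : Tensor4Field d}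

theorem act_mem (hL : IsElasticityField Y L) {η : TensorField d} (hη : η ∈ SymL2per Y) :
    L.act η ∈ SymL2per Y := by
  obtain ⟨M, hM⟩ := hL.bounded
  refine ⟨fun i j => ?_, fun i j => ?_⟩
  · refine Finset.sum_congr rfl fun k _ => Finset.sum_congr rfl fun l _ => ?_
    congr 1
    refine AEEqFun.ext ?_
    filter_upwards [hL.elastic] with x hx
    exact hx.minor_left i j k l
  · exact (L2perSubmodule Y).sum_mem fun k _ => (L2perSubmodule Y).sum_mem fun l _ =>
      mul_mem_L2per (hL.periodic i j k l) (hM i j k l) (hη.2 k l)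

/-- The integrands agree almost everywhere, by major symmetry and the exchange of the two index
pairs, so no integrability is needed. -/
theorem duality_act_comm (hL : IsElasticityField Y L) (η η' : TensorField d) :
    duality V (L.act η) η' = duality V (L.act η') η := by
  have h1 : ∀ ξ : TensorField d, ∀ᵐ x ∂(volume : Measure (Pt d)), ∀ i j,
      L.act ξ i j x = ∑ k, ∑ l, L i j k l x * ξ k l x := fun ξ =>
    ae_all_iff.2 fun i => ae_all_iff.2 fun j => L.coeFn_act ξ i j
  rw [duality, duality]
  refine integral_congr_ae (Measure.ae_smul_measure (ae_restrict_of_ae ?_) _)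
  filter_upwards [h1 η, h1 η', hL.elastic] with x e1 e2 hx
  simp only [e1, e2, Finset.sum_mul]
  have hswap : ∀ f : Fin d → Fin d → Fin d → Fin d → ℝ,
      ∑ i, ∑ j, ∑ k, ∑ l, f i j k l = ∑ i, ∑ j, ∑ k, ∑ l, f k l i j := by
    intro f
    have e : ∀ F : Fin d → Fin d → Fin d → Fin d → ℝ, ∑ i, ∑ j, ∑ k, ∑ l, F i j k l =
        ∑ z : Fin d × Fin d, ∑ w : Fin d × Fin d, F z.1 z.2 w.1 w.2 := fun F => by
      simp only [Fintype.sum_prod_type]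
    rw [e, e, Finset.sum_comm]
  rw [hswap]
  refine Finset.sum_congr rfl fun i _ => Finset.sum_congr rfl fun j _ =>
    Finset.sum_congr rfl fun k _ => Finset.sum_congr rfl fun l _ => ?_
  have := hx.major i j k l
  rw [this]
  ring

/-- The integrand is nonnegative and vanishes only where η does, so a zero integral forces η = 0. No
uniform lower bound on `L` enters. -/
theorem duality_act_pos (hL : IsElasticityField Y L) (hV : IsUnitCell Y V) {η : TensorField d}
    (hη : η ∈ SymL2per Y) (h0 : η ≠ 0) : 0 < duality V (L.act η) η := by
  have hLη := hL.act_mem hη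
  let Q : Torus d → ℝ := fun θ =>
    ∑ i, ∑ j, L.act η i j (ofTorus Y θ) * η i j (ofTorus Y θ)
  have hQ : duality V (L.act η) η = ∫ θ, Q θ := by
    have hp : AEPeriodic Y fun x => ∑ i, ∑ j, L.act η i j x * η i j x :=
      AEPeriodic.sum _ fun i _ => AEPeriodic.sum _ fun j _ =>
        AEPeriodic.mul (hLη.2 i j).2 (hη.2 i j).2
    have hm : AEStronglyMeasurable (fun x => ∑ i, ∑ j, L.act η i j x * η i j x)
        (volume : Measure (Pt d)) :=
      Finset.aestronglyMeasurable_fun_sum _ fun i _ =>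
        Finset.aestronglyMeasurable_fun_sum _ fun j _ =>
          (L.act η i j).aestronglyMeasurable.mul (η i j).aestronglyMeasurable
    exact hp.setAverage hm hV
  have hQi : Integrable Q (volume : Measure (Torus d)) :=
    integrable_finsetSum _ fun i _ => integrable_finsetSum _ fun j _ =>
      integrable_mul_ofTorus (hLη.2 i j) (hη.2 i j)
  have hpt : ∀ᵐ θ ∂(volume : Measure (Torus d)), (0 ≤ Q θ) ∧
      (Q θ = 0 → ∀ i j, η i j (ofTorus Y θ) = 0) := by
    have h1 : ∀ᵐ x ∂(volume : Measure (Pt d)), ∀ i j,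
        L.act η i j x = ∑ k, ∑ l, L i j k l x * η k l x :=
      ae_all_iff.2 fun i => ae_all_iff.2 fun j => L.coeFn_act η i j
    filter_upwards [ae_ofTorus (Y := Y) h1, ae_ofTorus (Y := Y) hL.elastic] with θ e1 hx
    let A : Matrix (Fin d) (Fin d) ℝ := fun i j => η i j (ofTorus Y θ)
    have hA : A.IsSymm := Matrix.IsSymm.ext fun i j => by simp only [A, hη.1 i j]
    have hQA : Q θ = ∑ i, ∑ j, ∑ k, ∑ l, L i j k l (ofTorus Y θ) * A k l * A i j := by
      simp only [Q, e1, Finset.sum_mul, A]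
    by_cases hA0 : A = 0
    · refine ⟨?_, fun _ i j => congrFun (congrFun hA0 i) j⟩
      rw [hQA, hA0]
      simp
    · have hpos := hx.pos A hA hA0
      rw [← hQA] at hpos
      exact ⟨hpos.le, fun h => absurd h hpos.ne'⟩
  have hnn : 0 ≤ᵐ[volume] Q := hpt.mono fun θ h => h.1
  rw [hQ]
  refine lt_of_le_of_ne (integral_nonneg_of_ae hnn) fun hz => h0 ?_
  have hQ0 := (integral_eq_zero_iff_of_nonneg_ae hnn hQi).1 hz.symm
  have hη0 : ∀ᵐ θ ∂(volume : Measure (Torus d)), ∀ i j, η i j (ofTorus Y θ) = 0 := by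
    filter_upwards [hpt, hQ0] with θ h1 h2 using h1.2 h2
  funext i j
  refine AEEqFun.ext ?_
  filter_upwards [(quasiMeasurePreserving_toTorus Y).ae hη0, AEPeriodic.ae_eq (hη.2 i j).2,
    AEEqFun.coeFn_zero (α := Pt d) (β := ℝ) (μ := volume)] with x h1 h2 h3
  rw [← h2, h1 i j]
  exact h3.symm

end IsElasticityField

/-! ### The energetic scalar product and the Green's operator -/

section Reference

variable {L₀ : Tensor4 d}

theorem strainInner_comm (Y : Module.Basis (Fin d) ℝ (Pt d)) (hL₀ : IsElasticityTensor L₀)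
    (η η' : TensorField d) : strainInner V L₀ η η' = strainInner V L₀ η' η := by
  rw [strainInner, strainInner, ← constField_act, ← constField_act]
  exact (isElasticityField_constField (Y := Y) hL₀).duality_act_comm η η'

theorem strainInner_self_pos (hL₀ : IsElasticityTensor L₀) (hV : IsUnitCell Y V)
    {η : TensorField d} (hη : η ∈ SymL2per Y) (h0 : η ≠ 0) : 0 < strainInner V L₀ η η := by
  rw [strainInner, ← constField_act]
  exact (isElasticityField_constField hL₀).duality_act_pos hV hη h0

theorem act_add (η η' : TensorField d) : L₀.act (η + η') = L₀.act η + L₀.act η' := by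
  simp only [← constField_act, Tensor4Field.act_add]

theorem act_smul (c : ℝ) (η : TensorField d) : L₀.act (c • η) = c • L₀.act η := by
  simp only [← constField_act, Tensor4Field.act_smul]

theorem strainInner_add_left (hL₀ : IsElasticityTensor L₀) (hV : IsUnitCell Y V)
    {η η' ξ : TensorField d} (hη : η ∈ SymL2per Y) (hη' : η' ∈ SymL2per Y) (hξ : ξ ∈ SymL2per Y) :
    strainInner V L₀ (η + η') ξ = strainInner V L₀ η ξ + strainInner V L₀ η' ξ := by
  rw [strainInner, act_add, duality_add_left hV (act_mem hL₀ hη) (act_mem hL₀ hη') hξ]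
  rfl

theorem strainInner_smul_left (hL₀ : IsElasticityTensor L₀) (hV : IsUnitCell Y V) (c : ℝ)
    {η ξ : TensorField d} (hη : η ∈ SymL2per Y) (hξ : ξ ∈ SymL2per Y) :
    strainInner V L₀ (c • η) ξ = c * strainInner V L₀ η ξ := by
  rw [strainInner, act_smul, duality_smul_left hV c (act_mem hL₀ hη) hξ]
  rfl

theorem strainInner_neg_left (hL₀ : IsElasticityTensor L₀) (hV : IsUnitCell Y V)
    {η ξ : TensorField d} (hη : η ∈ SymL2per Y) (hξ : ξ ∈ SymL2per Y) :
    strainInner V L₀ (-η) ξ = -strainInner V L₀ η ξ := by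
  rw [← neg_one_smul ℝ η, strainInner_smul_left hL₀ hV _ hη hξ, neg_one_mul]

/-- Expansion of the energetic square norm along a line. -/
theorem strainInner_add_smul (hL₀ : IsElasticityTensor L₀) (hV : IsUnitCell Y V)
    {η ξ : TensorField d} (hη : η ∈ SymL2per Y) (hξ : ξ ∈ SymL2per Y) (t : ℝ) :
    strainInner V L₀ (η + t • ξ) (η + t • ξ) = strainInner V L₀ η η +
      2 * t * strainInner V L₀ η ξ + t ^ 2 * strainInner V L₀ ξ ξ := by
  have ht := (symSubmodule Y).smul_mem t hξ
  have hs := (symSubmodule Y).add_mem hη ht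
  rw [strainInner_add_left hL₀ hV hη ht hs, strainInner_smul_left hL₀ hV t hξ hs,
    strainInner_comm Y hL₀ η, strainInner_comm Y hL₀ ξ,
    strainInner_add_left hL₀ hV hη ht hη, strainInner_add_left hL₀ hV hη ht hξ,
    strainInner_smul_left hL₀ hV t hξ hη, strainInner_smul_left hL₀ hV t hξ hξ,
    strainInner_comm Y hL₀ ξ η]
  ring

/-- The residual L₀e - τ is divergence-free, hence orthogonal to `E₀`: this is the weak form of the
Eshelby problem. -/
theorem IsEshelbySolution.strainInner_eq (hL₀ : IsElasticityTensor L₀) (hV : IsUnitCell Y V)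
    {τ e h : TensorField d} (hτ : τ ∈ SymL2per Y) (he : IsEshelbySolution Y V L₀ τ e)
    (hh : h ∈ E₀ Y) : strainInner V L₀ e h = duality V τ h := by
  have hS := (mem_S_iff hV).1 he.2
  have h0 := duality_eq_zero_of_isDivFree hV hS.1 hS.2 hh
  rw [duality_sub_left hV (act_mem hL₀ he.1.1) hτ hh.1] at h0
  rw [strainInner]
  linarith

/-- Testing with ξ = g - g' and using definiteness; this single fact gives uniqueness for the
Eshelby problem and for gradients, and the linearity of `Γ₀`. -/
theorem eq_of_strainInner_eq (hL₀ : IsElasticityTensor L₀) (hV : IsUnitCell Y V)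
    {g g' : TensorField d} (hg : g ∈ E₀ Y) (hg' : g' ∈ E₀ Y)
    (h : ∀ ξ ∈ E₀ Y, strainInner V L₀ g ξ = strainInner V L₀ g' ξ) : g = g' := by
  by_contra hne
  have hd : g - g' ∈ E₀ Y := (strainSubmodule Y).sub_mem hg hg'
  have hpos := strainInner_self_pos (V := V) hL₀ hV hd.1 (sub_ne_zero.2 hne)
  have hneg : -g' ∈ SymL2per Y := (symSubmodule Y).neg_mem hg'.1
  have e : strainInner V L₀ (g - g') (g - g') =
      strainInner V L₀ g (g - g') - strainInner V L₀ g' (g - g') := by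
    have h1 := strainInner_add_left hL₀ hV hg.1 hneg hd.1
    rw [strainInner_neg_left hL₀ hV hg'.1 hd.1, ← sub_eq_add_neg, ← sub_eq_add_neg] at h1
    exact h1
  rw [e, h _ hd, sub_self] at hpos
  exact lt_irrefl _ hpos

theorem existsUnique_isEshelbySolution (hL₀ : IsElasticityTensor L₀) (hV : IsUnitCell Y V)
    {τ : TensorField d} (hτ : τ ∈ SymL2per Y) : ∃! e, IsEshelbySolution Y V L₀ τ e := by
  obtain ⟨e, he⟩ := exists_isEshelbySolution hV hL₀ hτ
  refine ⟨e, he, fun e' he' => eq_of_strainInner_eq hL₀ hV he'.1 he.1 fun ξ hξ => ?_⟩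
  rw [he'.strainInner_eq hL₀ hV hτ hξ, he.strainInner_eq hL₀ hV hτ hξ]

theorem isEshelbySolution_Γ₀ (hL₀ : IsElasticityTensor L₀) (hV : IsUnitCell Y V)
    {τ : TensorField d} (hτ : τ ∈ SymL2per Y) :
    IsEshelbySolution Y V L₀ τ (Γ₀ Y V L₀ τ) := by
  have h := exists_isEshelbySolution hV hL₀ hτ
  rw [Γ₀, dif_pos h]
  exact h.choose_spec

theorem Γ₀_mem (hL₀ : IsElasticityTensor L₀) (hV : IsUnitCell Y V) {τ : TensorField d}
    (hτ : τ ∈ SymL2per Y) : Γ₀ Y V L₀ τ ∈ E₀ Y :=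
  (isEshelbySolution_Γ₀ hL₀ hV hτ).1

theorem strainInner_Γ₀ (hL₀ : IsElasticityTensor L₀) (hV : IsUnitCell Y V) {τ h : TensorField d}
    (hτ : τ ∈ SymL2per Y) (hh : h ∈ E₀ Y) : strainInner V L₀ (Γ₀ Y V L₀ τ) h = duality V τ h :=
  (isEshelbySolution_Γ₀ hL₀ hV hτ).strainInner_eq hL₀ hV hτ hh

theorem Γ₀_add_smul (hL₀ : IsElasticityTensor L₀) (hV : IsUnitCell Y V) {τ τ' : TensorField d}
    (hτ : τ ∈ SymL2per Y) (hτ' : τ' ∈ SymL2per Y) (t : ℝ) :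
    Γ₀ Y V L₀ (τ + t • τ') = Γ₀ Y V L₀ τ + t • Γ₀ Y V L₀ τ' := by
  have ht := (symSubmodule Y).smul_mem t hτ'
  have hs := (symSubmodule Y).add_mem hτ ht
  have g := Γ₀_mem hL₀ hV hτ
  have g' := Γ₀_mem hL₀ hV hτ'
  have gt := (strainSubmodule Y).smul_mem t g'
  refine eq_of_strainInner_eq hL₀ hV (Γ₀_mem hL₀ hV hs) ((strainSubmodule Y).add_mem g gt)
    fun ξ hξ => ?_
  rw [strainInner_Γ₀ hL₀ hV hs hξ, strainInner_add_left hL₀ hV g.1 gt.1 hξ.1,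
    strainInner_smul_left hL₀ hV t g'.1 hξ.1, strainInner_Γ₀ hL₀ hV hτ hξ,
    strainInner_Γ₀ hL₀ hV hτ' hξ, duality_add_left hV hτ ht hξ.1, duality_smul_left hV t hτ' hξ.1]

/-- The gradient of a functional that is quadratic along lines. -/
theorem isGradient_iff_eq (hL₀ : IsElasticityTensor L₀) (hV : IsUnitCell Y V)
    {F : TensorField d → ℝ} {e g : TensorField d} (hg : g ∈ E₀ Y)
    (hF : ∀ h ∈ E₀ Y, ∃ B : ℝ, ∀ t : ℝ,
      F (e + t • h) = F e + t * strainInner V L₀ g h + t ^ 2 * B) (g' : TensorField d) :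
    IsGradient Y V L₀ F e g' ↔ g' = g := by
  have hgrad : IsGradient Y V L₀ F e g := by
    refine ⟨hg, fun h hh => ?_⟩
    obtain ⟨B, hB⟩ := hF h hh
    have hlim : Tendsto (fun t : ℝ => strainInner V L₀ g h + t * B) (𝓝[≠] 0)
        (𝓝 (strainInner V L₀ g h)) := by
      have hc : Continuous fun t : ℝ => strainInner V L₀ g h + t * B := by fun_prop
      simpa using (hc.tendsto 0).mono_left nhdsWithin_le_nhds
    refine hlim.congr' ?_
    filter_upwards [self_mem_nhdsWithin] with t ht
    have ht' : t ≠ 0 := ht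
    rw [hB]
    field_simp
    ring
  refine ⟨fun h' => ?_, fun h => h ▸ hgrad⟩
  exact eq_of_strainInner_eq hL₀ hV h'.1 hg fun ξ hξ =>
    tendsto_nhds_unique (h'.2 ξ hξ) (hgrad.2 ξ hξ)

end Reference

end PeriodicElasticity

end

/-! ### Gradients and descent directions -/

open PeriodicElasticity

theorem proposition3p2 {d : ℕ} (Y : Module.Basis (Fin d) ℝ (PeriodicElasticity.Pt d))
    (V : Set (PeriodicElasticity.Pt d)) (hV : PeriodicElasticity.IsUnitCell Y V)
    (L₀ : PeriodicElasticity.Tensor4 d) (hL₀ : PeriodicElasticity.IsElasticityTensor L₀)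
    (L : PeriodicElasticity.Tensor4Field d) (hL : PeriodicElasticity.IsElasticityField Y L)
    (ε : Matrix (Fin d) (Fin d) ℝ) (hε : ε.IsSymm) :
    -- the Eshelby problem that defines the Green's operator is well posed
    (∀ τ ∈ PeriodicElasticity.SymL2per Y,
      ∃! e, PeriodicElasticity.IsEshelbySolution Y V L₀ τ e) ∧
    ∀ e ∈ PeriodicElasticity.E₀ Y,
      -- the gradients of both functionals exist and are unique
      ∃ gJ gN : PeriodicElasticity.TensorField d,
        (∀ g, PeriodicElasticity.IsGradient Y V L₀
          (PeriodicElasticity.J V L ε) e g ↔ g = gJ) ∧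
        (∀ g, PeriodicElasticity.IsGradient Y V L₀
          (PeriodicElasticity.N Y V L₀ L ε) e g ↔ g = gN) ∧
        gJ = PeriodicElasticity.Γ₀ Y V L₀
          (L.act (PeriodicElasticity.uniformField ε + e)) ∧
        PeriodicElasticity.strainInner V L₀ gJ gN =
          PeriodicElasticity.duality V
            (L.act (PeriodicElasticity.Γ₀ Y V L₀
              (L.act (PeriodicElasticity.uniformField ε + e))))
            (PeriodicElasticity.Γ₀ Y V L₀
              (L.act (PeriodicElasticity.uniformField ε + e))) ∧
        (gJ ≠ 0 →
          0 < PeriodicElasticity.strainInner V L₀ gJ gN ∧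
          PeriodicElasticity.IsDescentDirection Y V L₀
            (PeriodicElasticity.J V L ε) e (-gN) ∧
          PeriodicElasticity.IsDescentDirection Y V L₀
            (PeriodicElasticity.N Y V L₀ L ε) e (-gJ)) := by
  refine ⟨fun τ hτ => existsUnique_isEshelbySolution hL₀ hV hτ, fun e he => ?_⟩
  have hεs : uniformField ε ∈ SymL2per Y := uniformField_mem hε
  have hE : uniformField ε + e ∈ SymL2per Y := (symSubmodule Y).add_mem hεs he.1
  have hτ := hL.act_mem hE
  set τ := L.act (uniformField ε + e) with hτdef
  have hg : Γ₀ Y V L₀ τ ∈ E₀ Y := Γ₀_mem hL₀ hV hτ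
  set g := Γ₀ Y V L₀ τ
  have hτ' := hL.act_mem hg.1
  have hgN : Γ₀ Y V L₀ (L.act g) ∈ E₀ Y := Γ₀_mem hL₀ hV hτ'
  have hline : ∀ (h : TensorField d) (t : ℝ),
      L.act (uniformField ε + (e + t • h)) = τ + t • L.act h := by
    intro h t
    rw [hτdef, ← add_assoc, Tensor4Field.act_add, Tensor4Field.act_smul]
  have hJ : ∀ g', IsGradient Y V L₀ (J V L ε) e g' ↔ g' = g := by
    refine isGradient_iff_eq hL₀ hV hg fun h hh => ?_
    refine ⟨1 / 2 * duality V (L.act h) h, fun t => ?_⟩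
    have hLh := hL.act_mem hh.1
    have hth := (symSubmodule Y).smul_mem t hh.1
    have htL := (symSubmodule Y).smul_mem t hLh
    -- The two cross terms of the expansion coincide by the major symmetry of `L`, which cancels the
    -- factor 1/2.
    rw [strainInner_Γ₀ hL₀ hV hτ hh, J, hline, ← add_assoc,
      duality_add_right hV ((symSubmodule Y).add_mem hτ htL) hE hth,
      duality_add_left hV hτ htL hE, duality_add_left hV hτ htL hth,
      duality_smul_right hV t hτ hh.1, duality_smul_right hV t htL hh.1,
      duality_smul_left hV t hLh hE, duality_smul_left hV t hLh hh.1,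
      hL.duality_act_comm h, J, ← hτdef]
    ring
  have hN : ∀ g', IsGradient Y V L₀ (N Y V L₀ L ε) e g' ↔ g' = Γ₀ Y V L₀ (L.act g) := by
    refine isGradient_iff_eq hL₀ hV hgN fun h hh => ?_
    have hLh := hL.act_mem hh.1
    have hγ := Γ₀_mem hL₀ hV hLh
    refine ⟨1 / 2 * strainInner V L₀ (Γ₀ Y V L₀ (L.act h)) (Γ₀ Y V L₀ (L.act h)), fun t => ?_⟩
    -- The linear term is moved onto `h` by (g, Γ₀Lh)_e = ⟨Lh : g⟩ = ⟨Lg : h⟩ = (Γ₀Lg, h)_e.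
    rw [N, N, hline, Γ₀_add_smul hL₀ hV hτ hLh, strainInner_add_smul hL₀ hV hg.1 hγ.1,
      strainInner_comm Y hL₀ g (Γ₀ Y V L₀ (L.act h)), strainInner_Γ₀ hL₀ hV hLh hg, strainInner_Γ₀ hL₀ hV hτ' hh,
      hL.duality_act_comm h g]
    ring
  have hprod : strainInner V L₀ g (Γ₀ Y V L₀ (L.act g)) = duality V (L.act g) g := by
    rw [strainInner_comm Y hL₀, strainInner_Γ₀ hL₀ hV hτ' hg]
  refine ⟨g, Γ₀ Y V L₀ (L.act g), hJ, hN, rfl, hprod, fun h0 => ?_⟩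
  have hpos : 0 < strainInner V L₀ g (Γ₀ Y V L₀ (L.act g)) := by
    rw [hprod]
    exact hL.duality_act_pos hV hg.1 h0
  refine ⟨hpos, ⟨(strainSubmodule Y).neg_mem hgN, g, (hJ g).2 rfl, ?_⟩,
    ⟨(strainSubmodule Y).neg_mem hg, _, (hN _).2 rfl, ?_⟩⟩
  · rw [strainInner_neg_left hL₀ hV hgN.1 hg.1, strainInner_comm Y hL₀]
    linarith
  · rw [strainInner_neg_left hL₀ hV hg.1 hgN.1]
    linarith
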